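/- All graphs are finite and simple. For a connected graph $G$, let $n(G)$ be its number of vertices, $\omega(G)$ its clique number (the largest number of pairwise adjacent vertices), and $d_G$ its distance function. A set $W\subseteq V(G)$ is a local resolving set if for any two adjacent vertices $u,v\in V(G)\setminus W$ there is $w\in W$ with $d_G(u,w)\neq d_G(v,w)$; the local metric dimension $\dim_l(G)$ is the smallest cardinality of a local resolving set. For integers $\lambda\ge\mu\ge 1$ with $\lambda+\mu<n$, let $K_n^-(\lambda,\mu)$ be the graph obtained from the complete graph $K_n$ by removing the edges of a complete bipartite subgraph $K_{\lambda,\mu}$. **Theorem.** Let $G$ be a connected graph with $n(G)\ge 5$ and $\omega(G)\le n(G)-3$. Then $\dim_l(G)\le n(G)-3$. Moreover, $\dim_l(G)=n(G)-3$ if and only if $G$ is isomorphic to the cycle $C_5$, or to $K_{n(G)}^-(\lambda,\mu)$ for some integers $\lambda\ge\mu\ge 2$ with $\lambda+\mu<n(G)$. -/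

import Mathlib

/-- `W` is a local resolving set of `G`: any two adjacent vertices outside `W` have different
distances to some vertex of `W`. -/
def IsLocalResolvingSet {V : Type*} (G : SimpleGraph V) (W : Finset V) : Prop :=
  ∀ u v : V, u ∉ W → v ∉ W → G.Adj u v → ∃ w ∈ W, G.dist u w ≠ G.dist v w

/-- The local metric dimension of a finite graph: the least cardinality of a local resolving set. -/
noncomputable def localMetricDim {V : Type*} (G : SimpleGraph V) : ℕ :=
  sInf {k : ℕ | ∃ W : Finset V, IsLocalResolvingSet G W ∧ W.card = k}

/-- For a finite graph the minimum is over a nonempty set, hence it is attained. -/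
theorem exists_card_eq_localMetricDim {V : Type*} [Fintype V] (G : SimpleGraph V) :
    ∃ W : Finset V, IsLocalResolvingSet G W ∧ W.card = localMetricDim G :=
  Nat.sInf_mem (s := {k : ℕ | ∃ W : Finset V, IsLocalResolvingSet G W ∧ W.card = k})
    ⟨_, Finset.univ, fun u _ hu => absurd (Finset.mem_univ u) hu, rfl⟩

/-- The graph obtained from the complete graph on `Fin n` by removing the edges of the complete
bipartite subgraph with parts `{0, …, a - 1}` and `{a, …, a + b - 1}`. It is used only for
`a + b < n`, so that the parts have exactly `a` and `b` vertices. -/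
def completeMinusBipartite (n a b : ℕ) : SimpleGraph (Fin n) :=
  ⊤ \ SimpleGraph.fromRel (fun i j : Fin n => i.val < a ∧ a ≤ j.val ∧ j.val < a + b)

open SimpleGraph

/-- `S` is resolved from outside if any two adjacent vertices of `S` have different distances to
some vertex not in `S`, that is, if the complement of `S` is a local resolving set. -/
def ResolvedFromOutside {V : Type*} (G : SimpleGraph V) (S : Finset V) : Prop :=
  ∀ u ∈ S, ∀ v ∈ S, G.Adj u v → ∃ w ∉ S, G.dist u w ≠ G.dist v w

/-- `u` and `v` have the same closed neighbourhood. -/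
def ClosedTwin {V : Type*} (G : SimpleGraph V) (u v : V) : Prop :=
  ∀ w, (u = w ∨ G.Adj u w) ↔ (v = w ∨ G.Adj v w)

/-! ### Complements of local resolving sets, and closed twins -/

section Basics

variable {V : Type*} {G : SimpleGraph V}

theorem ResolvedFromOutside.mono {S T : Finset V} (hS : ResolvedFromOutside G S) (h : T ⊆ S) :
    ResolvedFromOutside G T := fun u hu v hv huv => by
  obtain ⟨w, hw, hd⟩ := hS u (h hu) v (h hv) huv
  exact ⟨w, fun hwT => hw (h hwT), hd⟩

theorem isLocalResolvingSet_compl_iff [Fintype V] [DecidableEq V] {S : Finset V} :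
    IsLocalResolvingSet G Sᶜ ↔ ResolvedFromOutside G S := by
  unfold IsLocalResolvingSet ResolvedFromOutside
  simp only [Finset.mem_compl, not_not]
  exact ⟨fun h u hu v hv => h u v hu hv, fun h u v hu hv => h u hu v hv⟩

/-- Shrinking a set only adds outside vertices, so the complement of a minimum local resolving set
can be cut down to exactly `k` elements. -/
theorem localMetricDim_le_iff [Fintype V] {k : ℕ} (hk : k ≤ Fintype.card V) :
    localMetricDim G ≤ Fintype.card V - k ↔ ∃ S : Finset V, S.card = k ∧ ResolvedFromOutside G S := by
  classical
  constructor
  · intro h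
    obtain ⟨W, hW, hc⟩ := exists_card_eq_localMetricDim G
    have hle : k ≤ Wᶜ.card := by
      rw [Finset.card_compl]; have := Finset.card_le_univ W; omega
    obtain ⟨S, hS, hSc⟩ := Finset.exists_subset_card_eq hle
    refine ⟨S, hSc, ResolvedFromOutside.mono ?_ hS⟩
    rwa [← isLocalResolvingSet_compl_iff, compl_compl]
  · rintro ⟨S, rfl, hS⟩
    exact Nat.sInf_le ⟨Sᶜ, isLocalResolvingSet_compl_iff.2 hS, Finset.card_compl S⟩

theorem dist_ne_of_not_adj_iff {u v w : V} (h : ¬(G.Adj u w ↔ G.Adj v w)) :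
    G.dist u w ≠ G.dist v w := fun hd => h (by rw [← dist_eq_one_iff_adj, hd, dist_eq_one_iff_adj])

/-- An isomorphism does not increase distances. -/
theorem Iso.dist_le {W : Type*} {H : SimpleGraph W} (e : G ≃g H) (hG : G.Connected) (u v : V) :
    H.dist (e u) (e v) ≤ G.dist u v := by
  obtain ⟨p, hp⟩ := hG.exists_walk_length_eq_dist u v
  rw [← hp, ← Walk.length_map e.toHom p]
  exact SimpleGraph.dist_le _

theorem Iso.dist_eq {W : Type*} {H : SimpleGraph W} (e : G ≃g H) (hG : G.Connected) (u v : V) :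
    H.dist (e u) (e v) = G.dist u v := by
  refine le_antisymm (Iso.dist_le e hG u v) ?_
  have := Iso.dist_le e.symm (e.connected_iff.1 hG) (e u) (e v)
  simpa using this

theorem ResolvedFromOutside.map {W : Type*} {H : SimpleGraph W} (e : G ≃g H) (hG : G.Connected)
    {S : Finset V} (hS : ResolvedFromOutside G S) :
    ResolvedFromOutside H (S.map e.toEquiv.toEmbedding) := by
  have key : ∀ u ∈ S, ∀ v ∈ S, H.Adj (e u) (e v) →
      ∃ w ∉ S.map e.toEquiv.toEmbedding, H.dist (e u) w ≠ H.dist (e v) w := by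
    intro u hu v hv huv
    obtain ⟨w, hw, hd⟩ := hS u hu v hv (e.map_adj_iff.1 huv)
    refine ⟨e w, fun h => hw ?_, by rwa [Iso.dist_eq e hG, Iso.dist_eq e hG]⟩
    obtain ⟨w', hw', h⟩ := Finset.mem_map.1 h
    exact e.injective h ▸ hw'
  intro u hu v hv huv
  obtain ⟨u', hu', rfl⟩ := Finset.mem_map.1 hu
  obtain ⟨v', hv', rfl⟩ := Finset.mem_map.1 hv
  exact key u' hu' v' hv' huv

theorem ClosedTwin.refl (u : V) : ClosedTwin G u u := fun _ => Iff.rfl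

theorem ClosedTwin.symm {u v : V} (h : ClosedTwin G u v) : ClosedTwin G v u := fun w => (h w).symm

theorem ClosedTwin.trans {u v w : V} (h : ClosedTwin G u v) (h' : ClosedTwin G v w) :
    ClosedTwin G u w := fun x => (h x).trans (h' x)

theorem ClosedTwin.adj {u v : V} (h : ClosedTwin G u v) (huv : u ≠ v) : G.Adj u v := by
  have := (h v).2 (Or.inl rfl)
  tauto

theorem ClosedTwin.adj_iff {u v w : V} (h : ClosedTwin G u v) (hu : u ≠ w) (hv : v ≠ w) :
    G.Adj u w ↔ G.Adj v w := by
  have := h w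
  tauto

/-- Adjacent vertices lie in both closed neighbourhoods, so a difference between these occurs at a
third vertex. -/
theorem exists_adj_not_iff {u v : V} (huv : G.Adj u v) (h : ¬ClosedTwin G u v) :
    ∃ w, u ≠ w ∧ v ≠ w ∧ ¬(G.Adj u w ↔ G.Adj v w) := by
  unfold ClosedTwin at h
  push Not at h
  obtain ⟨w, hw⟩ := h
  have := huv.symm
  refine ⟨w, ?_, ?_, ?_⟩
  · rintro rfl; tauto
  · rintro rfl; tauto
  · have := huv.ne
    intro h
    by_cases h1 : u = w
    · subst h1; tauto
    · by_cases h2 : v = w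
      · subst h2; tauto
      · tauto

/-- Exchanging two closed twins is an automorphism that fixes every other vertex. -/
theorem ClosedTwin.dist_eq {u v : V} (hG : G.Connected) (h : ClosedTwin G u v) {w : V}
    (hu : u ≠ w) (hv : v ≠ w) : G.dist u w = G.dist v w := by
  classical
  let e : G ≃g G := ⟨Equiv.swap u v, by
    intro a b
    have key : ∀ w, u ≠ w → v ≠ w → (G.Adj u w ↔ G.Adj v w) := fun w => h.adj_iff
    simp only [Equiv.swap_apply_def]
    split_ifs <;> subst_vars <;>
      grind [SimpleGraph.adj_comm, SimpleGraph.irrefl]⟩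
  have := Iso.dist_eq e hG u w
  have h1 : e u = v := Equiv.swap_apply_left u v
  have h2 : e w = w := Equiv.swap_apply_of_ne_of_ne hu.symm hv.symm
  rw [h1, h2] at this
  exact this.symm

theorem not_resolvedFromOutside_of_closedTwin (hG : G.Connected) {S : Finset V} {u v : V}
    (hu : u ∈ S) (hv : v ∈ S) (huv : u ≠ v) (h : ClosedTwin G u v) : ¬ResolvedFromOutside G S := by
  intro hS
  obtain ⟨w, hw, hd⟩ := hS u hu v hv (h.adj huv)
  exact hd (h.dist_eq hG (by rintro rfl; exact hw hu) (by rintro rfl; exact hw hv))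

/-- If adjacent, `u` and `v` are distinguished by a vertex other than `a`, `b`, `c`, `d`. -/
def SepAvoiding (G : SimpleGraph V) (a b c d u v : V) : Prop :=
  G.Adj u v → ∃ w, (w ≠ a ∧ w ≠ b ∧ w ≠ c ∧ w ≠ d) ∧ G.dist u w ≠ G.dist v w

theorem SepAvoiding.symm {a b c d u v : V} (h : SepAvoiding G a b c d u v) :
    SepAvoiding G a b c d v u := fun huv => by
  obtain ⟨w, hw, hd⟩ := h huv.symm
  exact ⟨w, hw, hd.symm⟩

theorem SepAvoiding.of_adj {a b c d u v : V} (w : V) (hw : w ≠ a ∧ w ≠ b ∧ w ≠ c ∧ w ≠ d)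
    (h : ¬(G.Adj u w ↔ G.Adj v w)) : SepAvoiding G a b c d u v :=
  fun _ => ⟨w, hw, dist_ne_of_not_adj_iff h⟩

theorem SepAvoiding.of_not_adj {a b c d u v : V} (h : ¬G.Adj u v) : SepAvoiding G a b c d u v :=
  fun h' => absurd h' h

theorem exists_resolvedFromOutside_of_sepAvoiding {a b c d : V}
    (hab : a ≠ b) (hac : a ≠ c) (had : a ≠ d) (hbc : b ≠ c) (hbd : b ≠ d) (hcd : c ≠ d)
    (sab : SepAvoiding G a b c d a b) (sac : SepAvoiding G a b c d a c)
    (sad : SepAvoiding G a b c d a d) (sbc : SepAvoiding G a b c d b c)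
    (sbd : SepAvoiding G a b c d b d) (scd : SepAvoiding G a b c d c d) :
    ∃ S : Finset V, S.card = 4 ∧ ResolvedFromOutside G S := by
  classical
  refine ⟨{a, b, c, d}, by simp [*], ?_⟩
  have key : ∀ u ∈ ({a, b, c, d} : Finset V), ∀ v ∈ ({a, b, c, d} : Finset V),
      u ≠ v → SepAvoiding G a b c d u v := by
    intro u hu v hv huv
    simp only [Finset.mem_insert, Finset.mem_singleton] at hu hv
    rcases hu with rfl | rfl | rfl | rfl <;> rcases hv with rfl | rfl | rfl | rfl <;>
      first
        | exact absurd rfl huv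
        | assumption
        | (apply SepAvoiding.symm; assumption)
  intro u hu v hv huv
  obtain ⟨w, hw, hd⟩ := key u hu v hv huv.ne huv
  exact ⟨w, by simpa using hw, hd⟩

/-- In a connected graph some edge leaves every proper nonempty set of vertices. -/
theorem exists_adj_boundary (hG : G.Connected) {A : Set V} {u v : V} (hu : u ∈ A) (hv : v ∉ A) :
    ∃ a ∈ A, ∃ b ∉ A, G.Adj a b := by
  obtain ⟨p⟩ := hG u v
  obtain ⟨d, _, h1, h2⟩ := p.exists_boundary_dart A hu hv
  exact ⟨d.fst, h1, d.snd, h2, d.adj⟩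

end Basics

/-! ### Triangle-free graphs -/

section TriangleFree

variable {V : Type*} {G : SimpleGraph V}

/-- In `{c₁, c₄, z, c₂}` the only possible edges are `c₁c₂` and `zc₂`, and `c₀` is adjacent to `c₁`
and `z` but not to `c₂`. -/
theorem exists_resolved_of_fiveCycle_pendant
    (ht : ∀ a b c, G.Adj a b → G.Adj b c → ¬G.Adj a c) {c₀ c₁ c₂ c₃ c₄ z : V}
    (h01 : G.Adj c₀ c₁) (h12 : G.Adj c₁ c₂) (h23 : G.Adj c₂ c₃) (h34 : G.Adj c₃ c₄)
    (h40 : G.Adj c₄ c₀) (hz : z ≠ c₀ ∧ z ≠ c₁ ∧ z ≠ c₂ ∧ z ≠ c₃ ∧ z ≠ c₄) (hz0 : G.Adj z c₀) :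
    ∃ S : Finset V, S.card = 4 ∧ ResolvedFromOutside G S := by
  have h02 := ht _ _ _ h01 h12
  have h24 := ht _ _ _ h23 h34
  have h14 := ht _ _ _ h01.symm h40.symm
  have h1z := ht _ _ _ h01.symm hz0.symm
  have h4z := ht _ _ _ h40 hz0.symm
  have hw : c₀ ≠ c₁ ∧ c₀ ≠ c₄ ∧ c₀ ≠ z ∧ c₀ ≠ c₂ :=
    ⟨h01.ne, h40.ne', hz.1.symm, by rintro rfl; exact h24 h40.symm⟩
  refine exists_resolvedFromOutside_of_sepAvoiding (a := c₁) (b := c₄) (c := z) (d := c₂)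
    (by rintro rfl; exact h24 h12.symm) hz.2.1.symm h12.ne hz.2.2.2.2.symm
    (by rintro rfl; exact h14 h12) hz.2.2.1
    (.of_not_adj h14) (.of_not_adj h1z) (.of_adj c₀ hw ?_) (.of_not_adj h4z)
    (.of_not_adj fun h => h24 h.symm) (.of_adj c₀ hw ?_)
  · intro h; exact h02 (h.1 h01.symm).symm
  · intro h; exact h02 (h.1 hz0).symm

/-- Let `c`, `b`, `a`, `u` end a geodesic from `w`. In `{u, v, b, c}` distances from `w` leave only
the edges `uv` and `bc`, both separated by the omitted vertex `a`. -/
theorem exists_resolved_of_long_odd (hG : G.Connected)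
    (ht : ∀ a b c, G.Adj a b → G.Adj b c → ¬G.Adj a c) {w u v : V} (huv : G.Adj u v)
    (hd : G.dist w u = G.dist w v) (hm : 3 ≤ G.dist w u) :
    ∃ S : Finset V, S.card = 4 ∧ ResolvedFromOutside G S := by
  have step : ∀ x, ∀ n, G.dist w x = n + 1 → ∃ y, G.Adj y x ∧ G.dist w y = n := by
    intro x n hx
    obtain ⟨p, hp⟩ := hG.exists_walk_length_eq_dist x w
    rw [dist_comm, hx] at hp
    cases p with
    | nil => simp at hp
    | @cons _ y _ h q =>
      refine ⟨y, h.symm, ?_⟩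
      have h1 := SimpleGraph.dist_le q
      have h2 := hG.dist_triangle (u := w) (v := y) (w := x)
      rw [dist_eq_one_iff_adj.2 h.symm] at h2
      rw [dist_comm] at h1
      simp at hp
      omega
  have adj_le : ∀ x y, G.Adj x y → G.dist w x ≤ G.dist w y + 1 := by
    intro x y h
    have h2 := hG.dist_triangle (u := w) (v := y) (w := x)
    rw [dist_eq_one_iff_adj.2 h.symm] at h2
    exact h2
  obtain ⟨m, hm⟩ := Nat.exists_eq_add_of_le' hm
  obtain ⟨a, hau, ha⟩ := step u (m + 2) hm
  obtain ⟨b, hba, hb⟩ := step a (m + 1) ha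
  obtain ⟨c, hcb, hc⟩ := step b m hb
  have nadj : ∀ x y, G.dist w y + 1 < G.dist w x → ¬G.Adj x y := fun x y h h' => by
    have := adj_le x y h'
    omega
  have nne : ∀ x y, G.dist w x ≠ G.dist w y → x ≠ y := by rintro x y h rfl; exact h rfl
  refine exists_resolvedFromOutside_of_sepAvoiding (a := u) (b := v) (c := b) (d := c)
    huv.ne (nne _ _ (by omega)) (nne _ _ (by omega)) (nne _ _ (by omega)) (nne _ _ (by omega))
    (nne _ _ (by omega)) (.of_adj a ?_ ?_) (.of_not_adj (nadj _ _ (by omega)))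
    (.of_not_adj (nadj _ _ (by omega))) (.of_not_adj (nadj _ _ (by omega)))
    (.of_not_adj (nadj _ _ (by omega))) (.of_adj a ?_ ?_)
  · exact ⟨nne _ _ (by omega), nne _ _ (by omega), nne _ _ (by omega), nne _ _ (by omega)⟩
  · intro h
    exact ht _ _ _ (h.1 hau.symm).symm huv.symm hau
  · exact ⟨nne _ _ (by omega), nne _ _ (by omega), nne _ _ (by omega), nne _ _ (by omega)⟩
  · intro h
    exact nadj a c (by omega) (h.1 hba).symm

theorem exists_resolved_or_cycle_of_triangleFree [Fintype V] (hG : G.Connected)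
    (hn : 5 ≤ Fintype.card V) (ht : ∀ a b c, G.Adj a b → G.Adj b c → ¬G.Adj a c) :
    (∃ S : Finset V, S.card = 4 ∧ ResolvedFromOutside G S) ∨ Nonempty (G ≃g cycleGraph 5) := by
  classical
  by_contra! hcon
  obtain ⟨hbad, hcyc⟩ := hcon
  obtain ⟨w⟩ := hG.nonempty
  -- Any four vertices other than `w` fail to be resolved, so in particular `w` is equidistant from
  -- the ends of some edge among them.
  have hcard : 4 ≤ (Finset.univ.erase w).card := by
    rw [Finset.card_erase_of_mem (Finset.mem_univ w), Finset.card_univ]; omega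
  obtain ⟨S, hS, hSc⟩ := Finset.exists_subset_card_eq hcard
  have hwS : w ∉ S := fun h => by simpa using hS h
  have hSb := hbad S hSc
  unfold ResolvedFromOutside at hSb
  push Not at hSb
  obtain ⟨u, hu, v, hv, huv, hd⟩ := hSb
  have hd := hd w hwS
  rw [dist_comm, dist_comm (u := v)] at hd
  have hwu : w ≠ u := by rintro rfl; exact hwS hu
  have hwv : w ≠ v := by rintro rfl; exact hwS hv
  have hm0 : G.dist w u ≠ 0 := by
    rw [Ne, hG.dist_eq_zero_iff]; exact hwu
  have hm1 : G.dist w u ≠ 1 := by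
    intro h
    have h' := hd ▸ h
    rw [dist_eq_one_iff_adj] at h h'
    exact ht _ _ _ h huv h'
  have hm3 : ¬3 ≤ G.dist w u := by
    intro h
    obtain ⟨T, hT, hT'⟩ := exists_resolved_of_long_odd hG ht huv hd h
    exact hbad T hT hT'
  have hm2 : G.dist w u = 2 := by omega
  have two : ∀ x, G.dist w x = 2 → ∃ y, G.Adj w y ∧ G.Adj y x := by
    intro x hx
    obtain ⟨p, hp⟩ := hG.exists_walk_length_eq_dist w x
    rw [hx] at hp
    cases p with
    | nil => simp at hp
    | @cons _ y _ h q =>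
      cases q with
      | nil => simp at hp
      | @cons _ z _ h' r =>
        cases r with
        | nil => exact ⟨y, h, h'⟩
        | cons => simp at hp
  obtain ⟨a, hwa, hau⟩ := two u hm2
  obtain ⟨b, hwb, hbv⟩ := two v (by omega)
  have hpend : ∀ z, z ≠ w ∧ z ≠ a ∧ z ≠ u ∧ z ≠ v ∧ z ≠ b →
      ¬G.Adj w z ∧ ¬G.Adj a z ∧ ¬G.Adj u z ∧ ¬G.Adj v z ∧ ¬G.Adj b z := by
    rintro z ⟨h0, h1, h2, h3, h4⟩
    have key : ∀ {c₀ c₁ c₂ c₃ c₄ : V}, G.Adj c₀ c₁ → G.Adj c₁ c₂ → G.Adj c₂ c₃ → G.Adj c₃ c₄ →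
        G.Adj c₄ c₀ → (z ≠ c₀ ∧ z ≠ c₁ ∧ z ≠ c₂ ∧ z ≠ c₃ ∧ z ≠ c₄) → ¬G.Adj c₀ z := by
      intro c₀ c₁ c₂ c₃ c₄ h01 h12 h23 h34 h40 hz hz0
      obtain ⟨T, hT, hT'⟩ := exists_resolved_of_fiveCycle_pendant ht h01 h12 h23 h34 h40 hz hz0.symm
      exact hbad T hT hT'
    -- The five rotations of the cycle `w a u v b`.
    exact ⟨key hwa hau huv hbv.symm hwb.symm ⟨h0, h1, h2, h3, h4⟩,
      key hau huv hbv.symm hwb.symm hwa ⟨h1, h2, h3, h4, h0⟩,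
      key huv hbv.symm hwb.symm hwa hau ⟨h2, h3, h4, h0, h1⟩,
      key hbv.symm hwb.symm hwa hau huv ⟨h3, h4, h0, h1, h2⟩,
      key hwb.symm hwa hau huv hbv.symm ⟨h4, h0, h1, h2, h3⟩⟩
  have hall : ∀ z, z = w ∨ z = a ∨ z = u ∨ z = v ∨ z = b := by
    intro z
    by_contra hz
    obtain ⟨x, hx, y, hy, hxy⟩ := exists_adj_boundary hG
      (A := {x | x = w ∨ x = a ∨ x = u ∨ x = v ∨ x = b}) (Or.inl rfl) hz
    simp only [Set.mem_ofPred_eq, not_or] at hx hy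
    have := hpend y hy
    rcases hx with rfl | rfl | rfl | rfl | rfl <;> tauto
  have hwu' : ¬G.Adj w u := ht _ _ _ hwa hau
  have hwv' : ¬G.Adj w v := ht _ _ _ hwb hbv
  have hav' : ¬G.Adj a v := ht _ _ _ hau huv
  have hub' : ¬G.Adj u b := ht _ _ _ huv hbv.symm
  have hab' : ¬G.Adj a b := ht _ _ _ hwa.symm hwb
  have hab : a ≠ b := by rintro rfl; exact hav' hbv
  let f : Fin 5 → V := ![w, a, u, v, b]
  have hf : Function.Bijective f := by
    constructor
    · have n1 := hwa.ne
      have n2 := hau.ne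
      have n3 := huv.ne
      have n4 := hbv.ne
      have n5 := hwb.ne
      have n6 : a ≠ v := by rintro rfl; exact hwv' hwa
      have n7 : u ≠ b := by rintro rfl; exact hwu' hwb
      intro i j hij
      fin_cases i <;> fin_cases j <;> simp [f] at hij ⊢ <;>
        first | exact absurd hij ‹_› | exact absurd hij.symm ‹_›
    · intro z
      rcases hall z with rfl | rfl | rfl | rfl | rfl
      exacts [⟨0, rfl⟩, ⟨1, rfl⟩, ⟨2, rfl⟩, ⟨3, rfl⟩, ⟨4, rfl⟩]
  refine hcyc.false (SimpleGraph.Iso.symm ⟨Equiv.ofBijective f hf, ?_⟩)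
  intro i j
  have e0 : (cycleGraph 5).Adj i j ↔ (i - j = 1 ∨ j - i = 1) := by
    simp [cycleGraph_adj]
  rw [e0]
  change G.Adj (f i) (f j) ↔ _
  fin_cases i <;> fin_cases j <;> simp [f, *, G.adj_comm] <;>
    first | decide | grind [SimpleGraph.adj_comm]

end TriangleFree

/-! ### The extremal graphs -/

section Extremal

theorem completeMinusBipartite_adj {n a b : ℕ} {i j : Fin n} :
    (completeMinusBipartite n a b).Adj i j ↔ i ≠ j ∧
      ¬(i.val < a ∧ a ≤ j.val ∧ j.val < a + b) ∧ ¬(j.val < a ∧ a ≤ i.val ∧ i.val < a + b) := by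
  simp only [completeMinusBipartite, sdiff_adj, top_adj, fromRel_adj]
  tauto

/-- The side of the removed bipartite graph on which a vertex lies; `2` if on neither. -/
def bipartitionSide (a b : ℕ) (i : ℕ) : Fin 3 := if i < a then 0 else if i < a + b then 1 else 2

theorem closedTwin_of_bipartitionSide_eq {n a b : ℕ} {i j : Fin n}
    (h : bipartitionSide a b i = bipartitionSide a b j) :
    ClosedTwin (completeMinusBipartite n a b) i j := by
  intro k
  simp only [completeMinusBipartite_adj]
  unfold bipartitionSide at h
  split_ifs at h <;> grind

theorem not_resolved_completeMinusBipartite {n a b : ℕ}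
    (hG : (completeMinusBipartite n a b).Connected) {S : Finset (Fin n)} (hS : S.card = 4) :
    ¬ResolvedFromOutside (completeMinusBipartite n a b) S := by
  obtain ⟨u, hu, v, hv, huv, h⟩ := Finset.exists_ne_map_eq_of_card_lt_of_maps_to
    (s := S) (t := (Finset.univ : Finset (Fin 3))) (by simp [hS])
    (f := fun i => bipartitionSide a b i) (fun _ _ => by simp)
  exact not_resolvedFromOutside_of_closedTwin hG hu hv huv (closedTwin_of_bipartitionSide_eq h)

/-- One vertex is taken from each part and one from neither. The second vertices `1` and `a + 1` of
the parts separate them; this is where both parts need two vertices. -/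
theorem exists_resolved_completeMinusBipartite {n a b : ℕ} (hb : 2 ≤ b) (hba : b ≤ a)
    (hab : a + b < n) : ∃ S : Finset (Fin n), S.card = 3 ∧
      ResolvedFromOutside (completeMinusBipartite n a b) S := by
  refine ⟨{⟨0, by omega⟩, ⟨a, by omega⟩, ⟨a + b, by omega⟩}, ?_, ?_⟩
  · rw [Finset.card_eq_three]
    exact ⟨_, _, _, by simp; omega, by simp; omega, by simp; omega, rfl⟩
  · intro u hu v hv huv
    have w1 : (⟨1, by omega⟩ : Fin n) ∉
        ({⟨0, by omega⟩, ⟨a, by omega⟩, ⟨a + b, by omega⟩} : Finset (Fin n)) := by simp; omega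
    have w2 : (⟨a + 1, by omega⟩ : Fin n) ∉
        ({⟨0, by omega⟩, ⟨a, by omega⟩, ⟨a + b, by omega⟩} : Finset (Fin n)) := by simp; omega
    simp only [Finset.mem_insert, Finset.mem_singleton] at hu hv
    by_cases h : (u.val = 0 ∨ v.val = 0)
    · refine ⟨_, w2, dist_ne_of_not_adj_iff ?_⟩
      rcases hu with rfl | rfl | rfl <;> rcases hv with rfl | rfl | rfl <;>
        simp [completeMinusBipartite_adj] at h huv ⊢ <;> omega
    · refine ⟨_, w1, dist_ne_of_not_adj_iff ?_⟩
      rcases hu with rfl | rfl | rfl <;> rcases hv with rfl | rfl | rfl <;>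
        simp [completeMinusBipartite_adj] at h huv ⊢ <;> omega

theorem not_resolved_cycleGraph_five {S : Finset (Fin 5)} (hS : S.card = 4) :
    ¬ResolvedFromOutside (cycleGraph 5) S := by
  intro h
  have hc : Sᶜ.card = 1 := by rw [Finset.card_compl, hS]; rfl
  obtain ⟨w, hw⟩ := Finset.card_eq_one.1 hc
  have hmem : ∀ i, i ∉ S ↔ i = w := fun i => by rw [← Finset.mem_compl, hw, Finset.mem_singleton]
  have adj : ∀ i j : Fin 5, (cycleGraph 5).Adj i j ↔ (i - j = 1 ∨ j - i = 1) := fun i j => by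
    simp [cycleGraph_adj]
  have n2 : w + 2 ∈ S := by
    by_contra h'
    exact absurd ((hmem _).1 h') (by clear * -; revert w; decide)
  have n3 : w + 3 ∈ S := by
    by_contra h'
    exact absurd ((hmem _).1 h') (by clear * -; revert w; decide)
  obtain ⟨x, hx, hd⟩ := h _ n2 _ n3 ((adj _ _).2 (by clear * -; revert w; decide))
  obtain rfl := (hmem x).1 hx
  -- The reflection `i ↦ 2x - i` fixes `x` and sends `x + 2` to `x + 3`.
  let e : cycleGraph 5 ≃g cycleGraph 5 := ⟨Equiv.subLeft (2 * x), by
    intro i j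
    rw [adj, adj]
    simp only [Equiv.subLeft_apply, sub_sub_sub_cancel_left]
    exact or_comm⟩
  have he := Iso.dist_eq e cycleGraph_connected (x + 2) x
  have e1 : e (x + 2) = x + 3 := by
    change 2 * x - (x + 2) = x + 3
    clear * -; revert x; decide
  have e2 : e x = x := by
    change 2 * x - x = x
    clear * -; revert x; decide
  rw [e1, e2] at he
  exact hd he.symm

theorem exists_resolved_cycleGraph_five :
    ∃ S : Finset (Fin 5), S.card = 3 ∧ ResolvedFromOutside (cycleGraph 5) S := by
  refine ⟨{0, 1, 3}, rfl, fun u hu v hv huv => ⟨2, by decide, dist_ne_of_not_adj_iff ?_⟩⟩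
  have adj : ∀ i j : Fin 5, (cycleGraph 5).Adj i j ↔ (i - j = 1 ∨ j - i = 1) := fun i j => by
    simp [cycleGraph_adj]
  simp only [adj] at huv ⊢
  revert u v
  decide

theorem card_eq_sum_fibers_fin_three {W : Type*} [Fintype W] (h : W → Fin 3) : Fintype.card W =
    (Finset.univ.filter fun v => h v = 0).card + (Finset.univ.filter fun v => h v = 1).card +
      (Finset.univ.filter fun v => h v = 2).card := by
  rw [← Finset.card_univ, Finset.card_eq_sum_card_fiberwise (f := h) (t := Finset.univ)
    (by simp), Fin.sum_univ_three]

/-- A graph whose only non-edges are all pairs between two disjoint sets is a complete graph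
without a complete bipartite graph. -/
theorem nonempty_iso_completeMinusBipartite {V : Type*} [Fintype V] {G : SimpleGraph V}
    {A B : Finset V} (hAB : Disjoint A B)
    (hadj : ∀ u v, G.Adj u v ↔ u ≠ v ∧ ¬(u ∈ A ∧ v ∈ B) ∧ ¬(v ∈ A ∧ u ∈ B)) :
    Nonempty (G ≃g completeMinusBipartite (Fintype.card V) A.card B.card) := by
  classical
  set n := Fintype.card V
  set a := A.card
  set b := B.card
  have hle : a + b ≤ n := by
    rw [← Finset.card_union_of_disjoint hAB]; exact Finset.card_le_univ _
  let f : V → Fin 3 := fun v => if v ∈ A then 0 else if v ∈ B then 1 else 2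
  let g : Fin n → Fin 3 := fun i => bipartitionSide a b i
  have hfA : ∀ v, f v = 0 ↔ v ∈ A := fun v => by simp only [f]; split_ifs <;> simp [*]
  have hfB : ∀ v, f v = 1 ↔ v ∈ B := fun v => by
    have := fun h : v ∈ A => Finset.disjoint_left.1 hAB h
    simp only [f]; split_ifs <;> simp_all
  have hgA : ∀ i, g i = 0 ↔ i.val < a := fun v => by
    simp only [g, bipartitionSide]; split_ifs <;> simp [*]
  have hgB : ∀ i, g i = 1 ↔ a ≤ i.val ∧ i.val < a + b := fun v => by
    simp only [g, bipartitionSide]; split_ifs <;> simp <;> omega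
  have c0 : (Finset.univ.filter fun v => f v = 0).card = a := by
    simp only [hfA, Finset.filter_univ_mem, a]
  have c1 : (Finset.univ.filter fun v => f v = 1).card = b := by
    simp only [hfB, Finset.filter_univ_mem, b]
  have d0 : (Finset.univ.filter fun v => g v = 0).card = a := by
    simp only [hgA]
    rw [Fin.card_filter_val_lt]; omega
  have d1 : (Finset.univ.filter fun v => g v = 1).card = b := by
    have h1 : (Finset.univ.filter fun i : Fin n => i.val < a + b).card = a + b := by
      rw [Fin.card_filter_val_lt]; omega
    have h2 : (Finset.univ.filter fun i : Fin n => i.val < a + b) =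
        (Finset.univ.filter fun v => g v = 0) ∪ (Finset.univ.filter fun v => g v = 1) := by
      ext i; simp only [hgA, hgB, Finset.mem_union, Finset.mem_filter, Finset.mem_univ, true_and]
      omega
    rw [h2, Finset.card_union_of_disjoint, d0] at h1
    · omega
    · rw [Finset.disjoint_left]; intro i; simp only [hgA, hgB, Finset.mem_filter]; omega
  have hcard : ∀ c : Fin 3, (Finset.univ.filter fun v => f v = c).card =
      (Finset.univ.filter fun i => g i = c).card := by
    have s1 := card_eq_sum_fibers_fin_three f
    have s2 := card_eq_sum_fibers_fin_three g
    rw [Fintype.card_fin] at s2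
    intro c
    fin_cases c
    · exact c0.trans d0.symm
    · exact c1.trans d1.symm
    · change Fintype.card V = _ at s1
      simp only [Fin.reduceFinMk]
      omega
  let e : V ≃ Fin n := Equiv.ofFiberEquiv (f := f) (g := g) fun c =>
    Fintype.equivOfCardEq (by rw [Fintype.card_subtype, Fintype.card_subtype, hcard])
  have he : ∀ v, g (e v) = f v := fun v => Equiv.ofFiberEquiv_map _ v
  refine ⟨⟨e, ?_⟩⟩
  intro u v
  rw [completeMinusBipartite_adj, hadj, ← hgA, ← hgA, ← hgB, ← hgB, he, he, hfA, hfA, hfB, hfB,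
    e.injective.ne_iff]

end Extremal

/-! ### The finite check on six vertices -/

section Check

/-- The number with the given binary digits, the lowest first. -/
def bitMask (b0 b1 b2 b3 b4 b5 : Bool) : ℕ :=
  Nat.add (cond b0 1 0) <| Nat.add (cond b1 2 0) <| Nat.add (cond b2 4 0) <|
    Nat.add (cond b3 8 0) <| Nat.add (cond b4 16 0) (cond b5 32 0)

/-- The numbers `r i` are the rows of the closed adjacency matrix of six vertices and `m` marks
vertices having a further closed twin; the test says that `a`, `b`, `c`, `d` are resolved from
outside. -/
def quadCheck (r : ℕ → ℕ) (m a b c d : ℕ) : Bool :=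
  let avail := Nat.lor m (Nat.xor 63
    (Nat.lor (Nat.pow 2 a) (Nat.lor (Nat.pow 2 b) (Nat.lor (Nat.pow 2 c) (Nat.pow 2 d)))))
  let sep (u v : ℕ) : Bool := Nat.beq (Nat.land (r u) (Nat.pow 2 v)) 0 ||
    !(Nat.beq (Nat.land (Nat.xor (r u) (r v)) avail) 0)
  sep a b && sep a c && sep a d && sep b c && sep b d && sep c d

/-- The `4`-subsets of `{0, …, 5}`. -/
def quads : List (ℕ × ℕ × ℕ × ℕ) :=
  [(0, 1, 2, 3), (0, 1, 2, 4), (0, 1, 2, 5), (0, 1, 3, 4), (0, 1, 3, 5), (0, 1, 4, 5),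
    (0, 2, 3, 4), (0, 2, 3, 5), (0, 2, 4, 5), (1, 2, 3, 4), (1, 2, 3, 5), (1, 2, 4, 5),
    (0, 3, 4, 5), (1, 3, 4, 5), (2, 3, 4, 5)]

/-- The closed adjacency matrix of a triangle and three further vertices. -/
def triangleMatrix (x0 x1 x2 y0 y1 y2 z0 z1 z2 xy xz yz : Bool) : ℕ → ℕ
  | 0 => bitMask true true true x0 y0 z0
  | 1 => bitMask true true true x1 y1 z1
  | 2 => bitMask true true true x2 y2 z2
  | 3 => bitMask x0 x1 x2 true xy xz
  | 4 => bitMask y0 y1 y2 xy true yz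
  | _ => bitMask z0 z1 z2 xz yz true

/-- Some four of the six vertices are resolved from outside. -/
def someQuad (x0 x1 x2 y0 y1 y2 z0 z1 z2 xy xz yz m0 m1 m2 : Bool) : Bool :=
  quads.any fun q => quadCheck (triangleMatrix x0 x1 x2 y0 y1 y2 z0 z1 z2 xy xz yz)
    (bitMask m0 m1 m2 false false false) q.1 q.2.1 q.2.2.1 q.2.2.2

/-- Two adjacent vertices together see a clique missing only one vertex. -/
def extendsByPair (p0 p1 p2 q0 q1 q2 pq m0 m1 m2 : Bool) : Bool :=
  pq && ((p0 && q0 && p1 && q1 && !m2) || (p0 && q0 && p2 && q2 && !m1) ||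
    (p1 && q1 && p2 && q2 && !m0))

/-- Three pairwise adjacent vertices together see a clique missing only two vertices. -/
def extendsByTriple (x0 x1 x2 y0 y1 y2 z0 z1 z2 xy xz yz m0 m1 m2 : Bool) : Bool :=
  xy && xz && yz && ((x0 && y0 && z0 && !m1 && !m2) || (x1 && y1 && z1 && !m0 && !m2) ||
    (x2 && y2 && z2 && !m0 && !m1))

/-- A vertex is complete to the triangle, or two triangle vertices are not separated. -/
def degenerateTypes (x0 x1 x2 y0 y1 y2 z0 z1 z2 : Bool) : Bool :=
  (x0 && x1 && x2) || (y0 && y1 && y2) || (z0 && z1 && z2) ||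
    (!(x0 ^^ x1) && !(y0 ^^ y1) && !(z0 ^^ z1)) || (!(x0 ^^ x2) && !(y0 ^^ y2) && !(z0 ^^ z2)) ||
    (!(x1 ^^ x2) && !(y1 ^^ y2) && !(z1 ^^ z2))

/-- Universal quantification over the booleans, as a boolean. -/
def forallBool (p : Bool → Bool) : Bool := p true && p false

theorem forallBool_iff {p : Bool → Bool} : forallBool p = true ↔ ∀ b, p b = true := by
  simp [forallBool, and_comm]

/-- The sets are coded as natural numbers so that the kernel can use its built-in arithmetic. The
nesting prunes the search: degenerate types are discarded before the edges among the outer vertices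
are chosen, and twin marks are tried only if no quadruple works without them. -/
theorem triangle_check : (forallBool fun x0 => forallBool fun x1 => forallBool fun x2 =>
    forallBool fun y0 => forallBool fun y1 => forallBool fun y2 =>
    forallBool fun z0 => forallBool fun z1 => forallBool fun z2 =>
    degenerateTypes x0 x1 x2 y0 y1 y2 z0 z1 z2 ||
    (forallBool fun xy => forallBool fun xz => forallBool fun yz =>
      someQuad x0 x1 x2 y0 y1 y2 z0 z1 z2 xy xz yz false false false ||
      (forallBool fun m0 => forallBool fun m1 => forallBool fun m2 =>
        extendsByPair x0 x1 x2 y0 y1 y2 xy m0 m1 m2 ||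
        extendsByPair x0 x1 x2 z0 z1 z2 xz m0 m1 m2 ||
        extendsByPair y0 y1 y2 z0 z1 z2 yz m0 m1 m2 ||
        extendsByTriple x0 x1 x2 y0 y1 y2 z0 z1 z2 xy xz yz m0 m1 m2 ||
        someQuad x0 x1 x2 y0 y1 y2 z0 z1 z2 xy xz yz m0 m1 m2))) = true := by
  decide +kernel

theorem triangle_cases (x0 x1 x2 y0 y1 y2 z0 z1 z2 xy xz yz m0 m1 m2 : Bool) :
    degenerateTypes x0 x1 x2 y0 y1 y2 z0 z1 z2 = true ∨
      extendsByPair x0 x1 x2 y0 y1 y2 xy m0 m1 m2 = true ∨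
      extendsByPair x0 x1 x2 z0 z1 z2 xz m0 m1 m2 = true ∨
      extendsByPair y0 y1 y2 z0 z1 z2 yz m0 m1 m2 = true ∨
      extendsByTriple x0 x1 x2 y0 y1 y2 z0 z1 z2 xy xz yz m0 m1 m2 = true ∨
      someQuad x0 x1 x2 y0 y1 y2 z0 z1 z2 xy xz yz false false false = true ∨
      someQuad x0 x1 x2 y0 y1 y2 z0 z1 z2 xy xz yz m0 m1 m2 = true := by
  have h := triangle_check
  simp only [forallBool_iff, Bool.or_eq_true] at h
  refine (h x0 x1 x2 y0 y1 y2 z0 z1 z2).elim Or.inl fun h => Or.inr ?_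
  refine (h xy xz yz).elim (fun h => Or.inr <| Or.inr <| Or.inr <| Or.inr <| Or.inl h) fun h => ?_
  have h := h m0 m1 m2
  simp only [or_assoc] at h
  exact h.imp_right <| Or.imp_right <| Or.imp_right <| Or.imp_right Or.inr

variable {V : Type*} {G : SimpleGraph V}

theorem exists_testBit_of_ne_zero {n : ℕ} (h : n ≠ 0) : ∃ i, n.testBit i = true := by
  by_contra! hc
  exact h (Nat.eq_of_testBit_eq fun i => by simpa using hc i)

/-- Soundness of the test. Rows are closed neighbourhoods because a further twin of the `w`-th
vertex sees each of the six vertices exactly as column `w` records, even the `w`-th vertex itself. A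
marked column is therefore available even when its vertex is among the four. -/
theorem exists_resolved_of_quadCheck {f : ℕ → V} {r : ℕ → ℕ} {m : ℕ}
    (hf : ∀ i < 6, ∀ j < 6, f i = f j → i = j)
    (hr : ∀ i < 6, ∀ j, (r i).testBit j = true ↔ (j < 6 ∧ (f i = f j ∨ G.Adj (f i) (f j))))
    (hm : ∀ i, m.testBit i = true → ∃ t, ClosedTwin G (f i) t ∧ ∀ j < 6, t ≠ f j)
    {q : ℕ × ℕ × ℕ × ℕ} (hq : q ∈ quads)
    (h : quadCheck r m q.1 q.2.1 q.2.2.1 q.2.2.2 = true) :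
    ∃ S : Finset V, S.card = 4 ∧ ResolvedFromOutside G S := by
  obtain ⟨a, b, c, d⟩ := q
  have hlt : (a < 6 ∧ b < 6 ∧ c < 6 ∧ d < 6) ∧
      (a ≠ b ∧ a ≠ c ∧ a ≠ d ∧ b ≠ c ∧ b ≠ d ∧ c ≠ d) := by
    have : ∀ q ∈ quads, (q.1 < 6 ∧ q.2.1 < 6 ∧ q.2.2.1 < 6 ∧ q.2.2.2 < 6) ∧
      (q.1 ≠ q.2.1 ∧ q.1 ≠ q.2.2.1 ∧ q.1 ≠ q.2.2.2 ∧ q.2.1 ≠ q.2.2.1 ∧ q.2.1 ≠ q.2.2.2 ∧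
        q.2.2.1 ≠ q.2.2.2) := by decide
    exact this _ hq
  obtain ⟨⟨ha, hb, hc, hd⟩, hab, hac, had, hbc, hbd, hcd⟩ := hlt
  have hne : ∀ i < 6, ∀ j < 6, i ≠ j → f i ≠ f j := fun i hi j hj hij h => hij (hf i hi j hj h)
  have sound : ∀ u < 6, ∀ v < 6, u ∈ [a, b, c, d] → v ∈ [a, b, c, d] →
      (Nat.beq (r u &&& 2 ^ v) 0 || !(Nat.beq ((r u ^^^ r v) &&&
        (m ||| (63 ^^^ (2 ^ a ||| (2 ^ b ||| (2 ^ c ||| 2 ^ d)))))) 0)) = true →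
      SepAvoiding G (f a) (f b) (f c) (f d) (f u) (f v) := by
    intro u hu v hv hua hva hs
    rw [Bool.or_eq_true, Nat.beq_eq] at hs
    rcases hs with hs | hs
    · refine .of_not_adj fun h => ?_
      have h1 := (hr u hu v).2 ⟨hv, Or.inr h⟩
      have h2 : (r u &&& 2 ^ v).testBit v = true := by
        rw [Nat.testBit_and, h1, Nat.testBit_two_pow_self]; rfl
      rw [hs] at h2
      simp at h2
    · have hs' : ((r u ^^^ r v) &&&
          (m ||| (63 ^^^ (2 ^ a ||| (2 ^ b ||| (2 ^ c ||| 2 ^ d)))))) ≠ 0 := by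
        intro h; rw [h] at hs; simp at hs
      obtain ⟨w, hw⟩ := exists_testBit_of_ne_zero hs'
      rw [Nat.testBit_and, Bool.and_eq_true, Nat.testBit_xor, Nat.testBit_or,
        Bool.or_eq_true] at hw
      obtain ⟨hw, hav⟩ := hw
      have hw6 : w < 6 := by
        by_contra hw6
        have h1 := (hr u hu w).not.2 (fun h => hw6 h.1)
        have h2 := (hr v hv w).not.2 (fun h => hw6 h.1)
        simp [h1, h2] at hw
      have hs : ¬((f u = f w ∨ G.Adj (f u) (f w)) ↔ (f v = f w ∨ G.Adj (f v) (f w))) := by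
        intro h
        have h1 : (r u).testBit w = (r v).testBit w := by
          rw [Bool.eq_iff_iff, hr u hu, hr v hv, h]
        simp [h1] at hw
      -- The separating column is either marked, and then the further twin separates, or it belongs
      -- to a vertex outside the quadruple.
      rcases hav with hav | hav
      · obtain ⟨t, htw, ht⟩ := hm w hav
        refine .of_adj t ⟨ht _ ha, ht _ hb, ht _ hc, ht _ hd⟩ fun h => hs ?_
        have e1 := htw (f u)
        have e2 := htw (f v)
        have n1 := ht u hu
        have n2 := ht v hv
        rw [G.adj_comm, G.adj_comm (f v) t] at h
        rw [eq_comm, G.adj_comm, e1, eq_comm (a := f v), G.adj_comm (f v), e2]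
        simpa only [n1, n2, false_or] using h
      · have hwne : ∀ x ∈ [a, b, c, d], x ≠ w := by
          rintro x hx rfl
          have h63 : Nat.testBit 63 x = true := by interval_cases x <;> rfl
          have h2 : (2 ^ a ||| (2 ^ b ||| (2 ^ c ||| 2 ^ d))).testBit x = true := by
            simp only [List.mem_cons, List.not_mem_nil, or_false] at hx
            simp only [Nat.testBit_or, Nat.testBit_two_pow, Bool.or_eq_true, decide_eq_true_eq]
            exact hx.imp Eq.symm (Or.imp Eq.symm (Or.imp Eq.symm Eq.symm))
          rw [Nat.testBit_xor, h63, h2] at hav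
          simp at hav
        refine .of_adj (f w) ⟨hne _ hw6 _ ha (hwne a (by simp)).symm,
          hne _ hw6 _ hb (hwne b (by simp)).symm, hne _ hw6 _ hc (hwne c (by simp)).symm,
          hne _ hw6 _ hd (hwne d (by simp)).symm⟩ fun h => hs ?_
        have hwu : f u ≠ f w := hne _ hu _ hw6 (hwne u hua)
        have hwv : f v ≠ f w := hne _ hv _ hw6 (hwne v hva)
        simpa only [hwu, hwv, false_or] using h
  unfold quadCheck at h
  rw [Bool.and_eq_true, Bool.and_eq_true, Bool.and_eq_true, Bool.and_eq_true,
    Bool.and_eq_true] at h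
  obtain ⟨⟨⟨⟨⟨h1, h2⟩, h3⟩, h4⟩, h5⟩, h6⟩ := h
  exact exists_resolvedFromOutside_of_sepAvoiding (hne _ ha _ hb hab) (hne _ ha _ hc hac)
    (hne _ ha _ hd had) (hne _ hb _ hc hbc) (hne _ hb _ hd hbd) (hne _ hc _ hd hcd)
    (sound _ ha _ hb (by simp) (by simp) h1) (sound _ ha _ hc (by simp) (by simp) h2)
    (sound _ ha _ hd (by simp) (by simp) h3) (sound _ hb _ hc (by simp) (by simp) h4)
    (sound _ hb _ hd (by simp) (by simp) h5) (sound _ hc _ hd (by simp) (by simp) h6)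

theorem testBit_bitMask (b0 b1 b2 b3 b4 b5 : Bool) (j : ℕ) :
    (bitMask b0 b1 b2 b3 b4 b5).testBit j = true ↔
      (j = 0 ∧ b0 = true) ∨ (j = 1 ∧ b1 = true) ∨ (j = 2 ∧ b2 = true) ∨ (j = 3 ∧ b3 = true) ∨
        (j = 4 ∧ b4 = true) ∨ (j = 5 ∧ b5 = true) := by
  rcases lt_or_ge j 6 with hj | hj
  · cases b0 <;> cases b1 <;> cases b2 <;> cases b3 <;> cases b4 <;> cases b5 <;>
      revert j <;> decide
  · have h1 : bitMask b0 b1 b2 b3 b4 b5 < 2 ^ 6 := by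
      cases b0 <;> cases b1 <;> cases b2 <;> cases b3 <;> cases b4 <;> cases b5 <;> decide
    have h2 := Nat.testBit_lt_two_pow (h1.trans_le (Nat.pow_le_pow_right two_pos hj))
    rw [h2]
    constructor
    · intro h; cases h
    · omega

end Check

/-! ### Four twin classes in a clique -/

section Clique

variable {V : Type*} {G : SimpleGraph V} {K : Finset V}

/-- Two vertices of a clique that are not twins are separated by a vertex outside it. -/
theorem exists_separator_notMem (hK : G.IsClique (K : Set V)) {k l : V} (hk : k ∈ K) (hl : l ∈ K)
    (h : ¬ClosedTwin G k l) : ∃ w ∉ K, ¬(G.Adj k w ↔ G.Adj l w) := by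
  have hkl : k ≠ l := by rintro rfl; exact h (ClosedTwin.refl _)
  obtain ⟨w, h1, h2, h3⟩ := exists_adj_not_iff (hK hk hl hkl) h
  exact ⟨w, fun hw => h3 ⟨fun _ => hK hl hw h2, fun _ => hK hk hw h1⟩, h3⟩

theorem exists_resolved_of_four_classes (hK : G.IsClique (K : Set V)) {a b c d : V}
    (ha : a ∈ K) (hb : b ∈ K) (hc : c ∈ K) (hd : d ∈ K)
    (hab : ¬ClosedTwin G a b) (hac : ¬ClosedTwin G a c) (had : ¬ClosedTwin G a d)
    (hbc : ¬ClosedTwin G b c) (hbd : ¬ClosedTwin G b d) (hcd : ¬ClosedTwin G c d) :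
    ∃ S : Finset V, S.card = 4 ∧ ResolvedFromOutside G S := by
  have hne : ∀ {u v : V}, ¬ClosedTwin G u v → u ≠ v := by
    rintro u v h rfl; exact h (ClosedTwin.refl _)
  have key : ∀ {u v : V}, u ∈ K → v ∈ K → ¬ClosedTwin G u v → SepAvoiding G a b c d u v := by
    intro u v hu hv h
    obtain ⟨w, hw, h'⟩ := exists_separator_notMem hK hu hv h
    have hwne : ∀ x ∈ K, w ≠ x := by rintro x hx rfl; exact hw hx
    exact .of_adj w ⟨hwne a ha, hwne b hb, hwne c hc, hwne d hd⟩ h'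
  exact exists_resolvedFromOutside_of_sepAvoiding (hne hab) (hne hac) (hne had) (hne hbc)
    (hne hbd) (hne hcd) (key ha hb hab) (key ha hc hac) (key ha hd had) (key hb hc hbc)
    (key hb hd hbd) (key hc hd hcd)

end Clique

/-! ### Exchange in a maximum clique, and three twin classes -/

section MaximumClique

variable {V : Type*} [Finite V] {G : SimpleGraph V} {K : Finset V}

/-- Otherwise `(K \ R) ∪ T` would be a larger clique. -/
theorem card_le_of_exchange (hK : G.IsMaximumClique K) {R T : Finset V}
    (hT : G.IsClique (T : Set V)) (hTK : ∀ t ∈ T, t ∉ K)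
    (h : ∀ t ∈ T, ∀ k ∈ K, k ∉ R → G.Adj t k) : T.card ≤ R.card := by
  classical
  have hcl : G.IsClique (((K \ R) ∪ T : Finset V) : Set V) := by
    intro u hu v hv huv
    simp only [Finset.coe_union, Finset.coe_sdiff, Set.mem_union, Set.mem_sdiff,
      Finset.mem_coe] at hu hv
    rcases hu with hu | hu <;> rcases hv with hv | hv
    · exact hK.isClique hu.1 hv.1 huv
    · exact (h v hv u hu.1 hu.2).symm
    · exact h u hu v hv.1 hv.2
    · exact hT hu hv huv
  have h1 := hK.maximum _ hcl
  rw [Finset.card_union_of_disjoint] at h1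
  · have h2 := Finset.le_card_sdiff R K
    omega
  · rw [Finset.disjoint_left]
    intro x hx hxT
    exact hTK x hxT (Finset.mem_sdiff.1 hx).1

theorem exists_not_adj_of_notMem (hK : G.IsMaximumClique K) {x : V} (hx : x ∉ K) :
    ∃ k ∈ K, ¬G.Adj x k := by
  by_contra! h
  have := card_le_of_exchange hK (R := ∅) (T := {x}) (by simp) (by simpa using hx)
    (by simpa using h)
  simp at this

theorem false_of_adj_pair (hK : G.IsMaximumClique K) {x y k : V} (hx : x ∉ K) (hy : y ∉ K)
    (hxy : G.Adj x y) (h : ∀ l ∈ K, l ≠ k → G.Adj x l ∧ G.Adj y l) : False := by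
  classical
  have := card_le_of_exchange hK (R := {k}) (T := {x, y})
    (by simpa using fun _ => hxy) (by simp [hx, hy])
    (by
      simp only [Finset.mem_insert, Finset.mem_singleton]
      rintro t (rfl | rfl) l hl hlk
      exacts [(h l hl hlk).1, (h l hl hlk).2])
  rw [Finset.card_pair hxy.ne] at this
  simp at this

theorem false_of_adj_triple (hK : G.IsMaximumClique K) {x y z k k' : V} (hx : x ∉ K) (hy : y ∉ K)
    (hz : z ∉ K) (hxy : G.Adj x y) (hxz : G.Adj x z) (hyz : G.Adj y z)
    (h : ∀ l ∈ K, l ≠ k → l ≠ k' → G.Adj x l ∧ G.Adj y l ∧ G.Adj z l) : False := by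
  classical
  have := card_le_of_exchange hK (R := {k, k'}) (T := {x, y, z})
    (by
      have := (is3Clique_triple_iff (G := G) (a := x) (b := y) (c := z)).2 ⟨hxy, hxz, hyz⟩
      exact this.isClique)
    (by simp [hx, hy, hz])
    (by
      simp only [Finset.mem_insert, Finset.mem_singleton, not_or]
      rintro t (rfl | rfl | rfl) l hl hlk
      exacts [(h l hl hlk.1 hlk.2).1, (h l hl hlk.1 hlk.2).2.1, (h l hl hlk.1 hlk.2).2.2])
  have h3 : ({x, y, z} : Finset V).card = 3 :=
    Finset.card_eq_three.2 ⟨x, y, z, hxy.ne, hxz.ne, hyz.ne, rfl⟩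
  rw [h3] at this
  exact absurd (this.trans Finset.card_le_two) (by omega)

/-- An edge leaving a clique of mutual twins would end at a vertex adjacent to the whole clique,
against maximality. -/
theorem not_closedTwin_all (hG : G.Connected) (hK : G.IsMaximumClique K) {k : V} (hk : k ∈ K)
    (h : ∀ l ∈ K, ClosedTwin G k l) (x : V) : x ∈ K := by
  by_contra hx
  obtain ⟨a, ha, b, hb, hab⟩ := exists_adj_boundary hG (A := (K : Set V)) (u := k) (v := x) hk
    hx
  obtain ⟨l, hl, hbl⟩ := exists_not_adj_of_notMem hK (x := b) hb
  have hal : ClosedTwin G a l := (h a ha).symm.trans (h l hl)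
  refine hbl ((hal.adj_iff ?_ ?_).1 hab).symm
  · rintro rfl; exact hb ha
  · rintro rfl; exact hb hl

theorem exists_resolved_of_three_classes [Fintype V] (hK : G.IsMaximumClique K)
    (hX : K.card + 3 ≤ Fintype.card V)
    {k₀ k₁ k₂ : V} (h0 : k₀ ∈ K) (h1 : k₁ ∈ K) (h2 : k₂ ∈ K)
    (h01 : ¬ClosedTwin G k₀ k₁) (h02 : ¬ClosedTwin G k₀ k₂) (h12 : ¬ClosedTwin G k₁ k₂)
    (hcov : ∀ l ∈ K, ClosedTwin G k₀ l ∨ ClosedTwin G k₁ l ∨ ClosedTwin G k₂ l) :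
    ∃ S : Finset V, S.card = 4 ∧ ResolvedFromOutside G S := by
  classical
  obtain ⟨w01, hw01, s01⟩ := exists_separator_notMem hK.isClique h0 h1 h01
  obtain ⟨w02, hw02, s02⟩ := exists_separator_notMem hK.isClique h0 h2 h02
  obtain ⟨w12, hw12, s12⟩ := exists_separator_notMem hK.isClique h1 h2 h12
  -- The separators of the three pairs may coincide; they are padded to exactly three vertices
  -- outside `K`.
  obtain ⟨X, hsub, hXK, hXc⟩ := Finset.exists_subsuperset_card_eq (s := {w01, w02, w12}) (t := Kᶜ)
    (n := 3) (by intro w; simp only [Finset.mem_insert, Finset.mem_singleton, Finset.mem_compl]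
                 rintro (rfl | rfl | rfl) <;> assumption) Finset.card_le_three
    (by rw [Finset.card_compl]; omega)
  obtain ⟨x, y, z, nxy, nxz, nyz, rfl⟩ := Finset.card_eq_three.1 hXc
  have hx : x ∉ K := by have := hXK (x := x); simpa using this
  have hy : y ∉ K := by have := hXK (x := y); simpa using this
  have hz : z ∉ K := by have := hXK (x := z); simpa using this
  have hKX : ∀ k ∈ K, k ≠ x ∧ k ≠ y ∧ k ≠ z := fun k hk =>
    ⟨by rintro rfl; exact hx hk, by rintro rfl; exact hy hk, by rintro rfl; exact hz hk⟩
  obtain ⟨n0x, n0y, n0z⟩ := hKX _ h0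
  obtain ⟨n1x, n1y, n1z⟩ := hKX _ h1
  obtain ⟨n2x, n2y, n2z⟩ := hKX _ h2
  have hne : ∀ {u v : V}, ¬ClosedTwin G u v → u ≠ v := by
    rintro u v h rfl; exact h (ClosedTwin.refl _)
  have n01 := hne h01
  have n02 := hne h02
  have n12 := hne h12
  have a01 : G.Adj k₀ k₁ := hK.isClique h0 h1 n01
  have a02 : G.Adj k₀ k₂ := hK.isClique h0 h2 n02
  have a12 : G.Adj k₁ k₂ := hK.isClique h1 h2 n12
  -- the vertices of `K` behave towards `t ∉ K` like their representatives
  have hrep : ∀ t ∉ K, ∀ l ∈ K, (ClosedTwin G k₀ l ∧ (G.Adj k₀ t ↔ G.Adj l t)) ∨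
      (ClosedTwin G k₁ l ∧ (G.Adj k₁ t ↔ G.Adj l t)) ∨
      (ClosedTwin G k₂ l ∧ (G.Adj k₂ t ↔ G.Adj l t)) := by
    intro t ht l hl
    have hlt : l ≠ t := by rintro rfl; exact ht hl
    have h : ∀ k ∈ K, ClosedTwin G k l → (G.Adj k t ↔ G.Adj l t) := fun k hk hkl =>
      hkl.adj_iff (by rintro rfl; exact ht hk) hlt
    rcases hcov l hl with h' | h' | h'
    · exact Or.inl ⟨h', h _ h0 h'⟩
    · exact Or.inr (Or.inl ⟨h', h _ h1 h'⟩)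
    · exact Or.inr (Or.inr ⟨h', h _ h2 h'⟩)
  have hprop : ∀ t ∉ K, ¬(G.Adj k₀ t ∧ G.Adj k₁ t ∧ G.Adj k₂ t) := by
    rintro t ht ⟨b0, b1, b2⟩
    obtain ⟨l, hl, htl⟩ := exists_not_adj_of_notMem hK ht
    have := hrep t ht l hl
    rw [G.adj_comm] at htl
    clear * - this htl b0 b1 b2
    tauto
  have hsep : ∀ {k l : V}, ∀ w ∈ ({w01, w02, w12} : Finset V), ¬(G.Adj k w ↔ G.Adj l w) →
      ¬((G.Adj k x ↔ G.Adj l x) ∧ (G.Adj k y ↔ G.Adj l y) ∧ (G.Adj k z ↔ G.Adj l z)) := by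
    intro k l w hw hs h
    have := hsub hw
    simp only [Finset.mem_insert, Finset.mem_singleton] at this
    rcases this with rfl | rfl | rfl
    exacts [hs h.1, hs h.2.1, hs h.2.2]
  have hs01 := hsep w01 (by simp) s01
  have hs02 := hsep w02 (by simp) s02
  have hs12 := hsep w12 (by simp) s12
  -- A second member of the class of `k` is a spare separator. Without one, deleting `k` from `K`
  -- deletes its whole class, leaving room for an exchange.
  let mult (k : V) : Prop := ∃ l ∈ K, l ≠ k ∧ ClosedTwin G k l
  have hsingle : ∀ {k l}, ¬mult k → l ∈ K → ClosedTwin G k l → l = k := by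
    intro k l hk hl h
    by_contra hlk
    exact hk ⟨l, hl, hlk, h⟩
  have hpair : ∀ {p q}, p ∉ K → q ∉ K → extendsByPair (decide (G.Adj k₀ p)) (decide (G.Adj k₁ p))
      (decide (G.Adj k₂ p)) (decide (G.Adj k₀ q)) (decide (G.Adj k₁ q)) (decide (G.Adj k₂ q))
      (decide (G.Adj p q)) (decide (mult k₀)) (decide (mult k₁)) (decide (mult k₂)) = true →
      False := by
    intro p q hp hq h
    simp only [extendsByPair, Bool.and_eq_true, Bool.or_eq_true, decide_eq_true_eq,
      Bool.not_eq_true', decide_eq_false_iff_not] at h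
    obtain ⟨hpq, h⟩ := h
    have aux : ∀ k, ((∀ l ∈ K, l ≠ k → G.Adj l p ∧ G.Adj l q)) → False := fun k h =>
      false_of_adj_pair hK hp hq hpq (k := k) fun l hl hlk =>
        ⟨(h l hl hlk).1.symm, (h l hl hlk).2.symm⟩
    rcases h with (h | h) | h
    · refine aux k₂ fun l hl hlk => ?_
      have e1 := hrep p hp l hl
      have e2 := hrep q hq l hl
      have e3 := fun h' => hlk (hsingle h.2 hl h')
      clear * - e1 e2 e3 h
      tauto
    · refine aux k₁ fun l hl hlk => ?_
      have e1 := hrep p hp l hl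
      have e2 := hrep q hq l hl
      have e3 := fun h' => hlk (hsingle h.2 hl h')
      clear * - e1 e2 e3 h
      tauto
    · refine aux k₀ fun l hl hlk => ?_
      have e1 := hrep p hp l hl
      have e2 := hrep q hq l hl
      have e3 := fun h' => hlk (hsingle h.2 hl h')
      clear * - e1 e2 e3 h
      tauto
  have htriple : extendsByTriple (decide (G.Adj k₀ x)) (decide (G.Adj k₁ x)) (decide (G.Adj k₂ x))
      (decide (G.Adj k₀ y)) (decide (G.Adj k₁ y)) (decide (G.Adj k₂ y))
      (decide (G.Adj k₀ z)) (decide (G.Adj k₁ z)) (decide (G.Adj k₂ z))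
      (decide (G.Adj x y)) (decide (G.Adj x z)) (decide (G.Adj y z))
      (decide (mult k₀)) (decide (mult k₁)) (decide (mult k₂)) = true → False := by
    intro h
    simp only [extendsByTriple, Bool.and_eq_true, Bool.or_eq_true, decide_eq_true_eq,
      Bool.not_eq_true', decide_eq_false_iff_not] at h
    obtain ⟨⟨⟨axy, axz⟩, ayz⟩, h⟩ := h
    have aux : ∀ k k' k'' : V, k'' ∈ K → ¬mult k → ¬mult k' →
        G.Adj k'' x ∧ G.Adj k'' y ∧ G.Adj k'' z →
        (∀ l ∈ K, ClosedTwin G k l ∨ ClosedTwin G k' l ∨ ClosedTwin G k'' l) → False := by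
      intro k k' k'' hk'' hk hk' hadj hc
      refine false_of_adj_triple hK hx hy hz axy axz ayz (k := k) (k' := k') fun l hl hlk hlk' => ?_
      have e3 := fun h' => hlk (hsingle hk hl h')
      have e4 := fun h' => hlk' (hsingle hk' hl h')
      have e5 : ClosedTwin G k'' l :=
        ((hc l hl).resolve_left e3).resolve_left e4
      have h' : ∀ t ∉ K, (G.Adj k'' t ↔ G.Adj l t) := fun t ht =>
        e5.adj_iff (by rintro rfl; exact ht hk'') (by rintro rfl; exact ht hl)
      exact ⟨((h' x hx).1 hadj.1).symm, ((h' y hy).1 hadj.2.1).symm, ((h' z hz).1 hadj.2.2).symm⟩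
    rcases h with (h | h) | h
    · exact aux k₁ k₂ k₀ h0 h.1.2 h.2 ⟨h.1.1.1.1, h.1.1.1.2, h.1.1.2⟩
        fun l hl => by have := hcov l hl; clear * - this; tauto
    · exact aux k₀ k₂ k₁ h1 h.1.2 h.2 ⟨h.1.1.1.1, h.1.1.1.2, h.1.1.2⟩
        fun l hl => by have := hcov l hl; clear * - this; tauto
    · exact aux k₀ k₁ k₂ h2 h.1.2 h.2 ⟨h.1.1.1.1, h.1.1.1.2, h.1.1.2⟩
        fun l hl => by have := hcov l hl; clear * - this; tauto
  let f : ℕ → V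
    | 0 => k₀ | 1 => k₁ | 2 => k₂ | 3 => x | 4 => y | _ => z
  have hf : ∀ i < 6, ∀ j < 6, f i = f j → i = j := by
    intro i hi j hj hij
    interval_cases i <;> interval_cases j <;> first
      | rfl
      | (exfalso; simp only [f] at hij; revert hij; first | assumption | (intro h; exact absurd h.symm ‹_›))
  have hr : ∀ i < 6, ∀ j, ((triangleMatrix (decide (G.Adj k₀ x)) (decide (G.Adj k₁ x))
      (decide (G.Adj k₂ x)) (decide (G.Adj k₀ y)) (decide (G.Adj k₁ y)) (decide (G.Adj k₂ y))
      (decide (G.Adj k₀ z)) (decide (G.Adj k₁ z)) (decide (G.Adj k₂ z))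
      (decide (G.Adj x y)) (decide (G.Adj x z)) (decide (G.Adj y z))) i).testBit j = true ↔
        (j < 6 ∧ (f i = f j ∨ G.Adj (f i) (f j))) := by
    intro i hi j
    rcases lt_or_ge j 6 with hj | hj
    · interval_cases i <;> interval_cases j <;>
        simp [-Nat.testBit_zero, triangleMatrix, testBit_bitMask, f, a01, a02, a12, a01.symm,
          a02.symm, a12.symm, nxy, nxz, nyz,
          n0x, n0y, n0z, n1x, n1y, n1z, n2x, n2y, n2z, nxy.symm, nxz.symm, nyz.symm, n0x.symm,
          n0y.symm, n0z.symm, n1x.symm, n1y.symm, n1z.symm, n2x.symm, n2y.symm, n2z.symm] <;>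
        exact G.adj_comm _ _
    · have hj' : ¬j < 6 := by omega
      simp only [hj', false_and, iff_false]
      interval_cases i <;> simp only [triangleMatrix, testBit_bitMask] <;> omega
  have hm : ∀ i, (bitMask (decide (mult k₀)) (decide (mult k₁)) (decide (mult k₂)) false false
      false).testBit i = true → ∃ t, ClosedTwin G (f i) t ∧ ∀ j < 6, t ≠ f j := by
    have aux : ∀ k, ¬ClosedTwin G k k₀ ∨ k = k₀ → ¬ClosedTwin G k k₁ ∨ k = k₁ →
        ¬ClosedTwin G k k₂ ∨ k = k₂ → mult k → ∃ t, ClosedTwin G k t ∧ ∀ j < 6, t ≠ f j := by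
      rintro k c0 c1 c2 ⟨t, ht, htk, hkt⟩
      obtain ⟨tx, ty, tz⟩ := hKX t ht
      refine ⟨t, hkt, fun j hj => ?_⟩
      interval_cases j
      · rintro rfl; exact c0.elim (fun h => h hkt) (fun h => htk h.symm)
      · rintro rfl; exact c1.elim (fun h => h hkt) (fun h => htk h.symm)
      · rintro rfl; exact c2.elim (fun h => h hkt) (fun h => htk h.symm)
      exacts [tx, ty, tz]
    intro i hi
    simp only [testBit_bitMask, decide_eq_true_eq, Bool.false_eq_true, and_false, or_false] at hi
    rcases hi with ⟨rfl, hi⟩ | ⟨rfl, hi⟩ | ⟨rfl, hi⟩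
    · exact aux k₀ (Or.inr rfl) (Or.inl h01) (Or.inl h02) hi
    · exact aux k₁ (Or.inl fun h => h01 h.symm) (Or.inr rfl) (Or.inl h12) hi
    · exact aux k₂ (Or.inl fun h => h02 h.symm) (Or.inl fun h => h12 h.symm) (Or.inr rfl) hi
  have hm0 : ∀ i, (bitMask false false false false false false).testBit i = true →
      ∃ t, ClosedTwin G (f i) t ∧ ∀ j < 6, t ≠ f j := by
    intro i hi
    simp [testBit_bitMask] at hi
  rcases triangle_cases (decide (G.Adj k₀ x)) (decide (G.Adj k₁ x)) (decide (G.Adj k₂ x))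
      (decide (G.Adj k₀ y)) (decide (G.Adj k₁ y)) (decide (G.Adj k₂ y))
      (decide (G.Adj k₀ z)) (decide (G.Adj k₁ z)) (decide (G.Adj k₂ z))
      (decide (G.Adj x y)) (decide (G.Adj x z)) (decide (G.Adj y z))
      (decide (mult k₀)) (decide (mult k₁)) (decide (mult k₂)) with h | h | h | h | h | h | h
  · exfalso
    have hxor : ∀ a b : Bool, (a ^^ b) = false ↔ a = b := by decide
    simp only [degenerateTypes, Bool.and_eq_true, Bool.or_eq_true, decide_eq_true_eq,
      Bool.not_eq_true', hxor, decide_eq_decide, and_assoc] at h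
    have px := hprop x hx
    have py := hprop y hy
    have pz := hprop z hz
    rcases h with ((((h | h) | h) | h) | h) | h
    exacts [px h, py h, pz h, hs01 h, hs02 h, hs12 h]
  · exact (hpair hx hy h).elim
  · exact (hpair hx hz h).elim
  · exact (hpair hy hz h).elim
  · exact (htriple h).elim
  · obtain ⟨q, hq, h⟩ := List.any_eq_true.1 h
    exact exists_resolved_of_quadCheck hf hr hm0 hq h
  · obtain ⟨q, hq, h⟩ := List.any_eq_true.1 h
    exact exists_resolved_of_quadCheck hf hr hm hq h

end MaximumClique

/-! ### Two twin classes in the maximum clique -/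

section TwoClasses

theorem ClosedTwin.adj_congr {V : Type*} {G : SimpleGraph V} {a b u v : V} (ha : ClosedTwin G a u)
    (hb : ClosedTwin G b v) (hab : ¬ClosedTwin G a b) : G.Adj a b ↔ G.Adj u v := by
  have h1 : G.Adj a b ↔ G.Adj u b := ha.adj_iff (by rintro rfl; exact hab (.refl _))
    (by rintro rfl; exact hab ha)
  have h2 : G.Adj b u ↔ G.Adj v u := hb.adj_iff (by rintro rfl; exact hab ha)
    (by rintro rfl; exact hab (ha.trans hb.symm))
  rw [h1, G.adj_comm, h2, G.adj_comm]

/-- Here `b` puts `a` within distance 2 of `c`, while `a'` is at distance at least 3. -/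
theorem dist_ne_of_common_neighbor {V : Type*} {G : SimpleGraph V} (hG : G.Connected)
    {a a' b c : V} (hab : G.Adj a b) (hbc : G.Adj b c) (hne : a' ≠ c) (hn : ¬G.Adj a' c)
    (h : ∀ w, G.Adj a' w → ¬G.Adj w c) : G.dist a c ≠ G.dist a' c := by
  intro hd
  have h2 : G.dist a c ≤ 2 := SimpleGraph.dist_le (Walk.cons hab (Walk.cons hbc Walk.nil))
  rw [hd] at h2
  obtain ⟨p, hp⟩ := hG.exists_walk_length_eq_dist a' c
  rw [← hp] at h2
  cases p with
  | nil => exact hne rfl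
  | @cons _ w _ h1 q =>
    cases q with
    | nil => exact hn h1
    | @cons _ w' _ h1' r =>
      cases r with
      | nil => exact h w h1 h1'
      | cons => simp at h2

variable {V : Type*} [Finite V] {G : SimpleGraph V} {K : Finset V} {k₁ k₂ : V}

/-- A maximum clique in which every vertex is a closed twin of one of the two non-twins `k₁`
and `k₂`. -/
structure IsTwoClassClique (G : SimpleGraph V) (K : Finset V) (k₁ k₂ : V) : Prop where
  isMaximumClique : G.IsMaximumClique K
  mem₁ : k₁ ∈ K
  mem₂ : k₂ ∈ K
  not_twin : ¬ClosedTwin G k₁ k₂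
  cover : ∀ l ∈ K, ClosedTwin G k₁ l ∨ ClosedTwin G k₂ l

namespace IsTwoClassClique

theorem symm (h : IsTwoClassClique G K k₁ k₂) : IsTwoClassClique G K k₂ k₁ :=
  ⟨h.isMaximumClique, h.mem₂, h.mem₁, fun h' => h.not_twin h'.symm, fun l hl => (h.cover l hl).symm⟩

theorem ne (h : IsTwoClassClique G K k₁ k₂) : k₁ ≠ k₂ := by
  rintro rfl; exact h.not_twin (.refl _)

theorem adj (h : IsTwoClassClique G K k₁ k₂) : G.Adj k₁ k₂ :=
  h.isMaximumClique.isClique h.mem₁ h.mem₂ h.ne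

theorem adj_iff (_ : IsTwoClassClique G K k₁ k₂) {k l t : V} (hk : k ∈ K) (hl : l ∈ K)
    (ht : t ∉ K) (hkl : ClosedTwin G k l) : G.Adj k t ↔ G.Adj l t :=
  hkl.adj_iff (by rintro rfl; exact ht hk) (by rintro rfl; exact ht hl)

theorem not_adj_both (h : IsTwoClassClique G K k₁ k₂) {t : V} (ht : t ∉ K) :
    ¬(G.Adj k₁ t ∧ G.Adj k₂ t) := by
  rintro ⟨h1, h2⟩
  obtain ⟨l, hl, hn⟩ := exists_not_adj_of_notMem h.isMaximumClique ht
  rcases h.cover l hl with h' | h'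
  · exact hn ((h.adj_iff h.mem₁ hl ht h').1 h1).symm
  · exact hn ((h.adj_iff h.mem₂ hl ht h').1 h2).symm

/-- If `k₂` is alone in its class, two adjacent outside neighbours of `k₁` could replace it and
enlarge the clique. -/
theorem exists_twin_or (h : IsTwoClassClique G K k₁ k₂) :
    (∃ l ∈ K, l ≠ k₂ ∧ ClosedTwin G k₂ l) ∨
      ∀ x ∉ K, ∀ y ∉ K, G.Adj x y → ¬(G.Adj k₁ x ∧ G.Adj k₁ y) := by
  by_contra! hc
  obtain ⟨h2, x, hx, y, hy, hxy, h1x, h1y⟩ := hc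
  refine false_of_adj_pair h.isMaximumClique hx hy hxy (k := k₂) fun l hl hl2 => ?_
  have hl1 : ClosedTwin G k₁ l := (h.cover l hl).resolve_right (h2 l hl hl2)
  exact ⟨((h.adj_iff h.mem₁ hl hx hl1).1 h1x).symm, ((h.adj_iff h.mem₁ hl hy hl1).1 h1y).symm⟩

theorem exists_adj (hG : G.Connected) (h : IsTwoClassClique G K k₁ k₂) {x : V} (hx : x ∉ K) :
    ∃ t ∉ K, G.Adj k₁ t ∨ G.Adj k₂ t := by
  obtain ⟨a, ha, b, hb, hab⟩ := exists_adj_boundary hG (A := (K : Set V)) (u := k₁) (v := x)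
    h.mem₁ hx
  refine ⟨b, hb, ?_⟩
  rcases h.cover a ha with h' | h'
  · exact Or.inl ((h.adj_iff h.mem₁ ha hb h').2 hab)
  · exact Or.inr ((h.adj_iff h.mem₂ ha hb h').2 hab)

/-- The case where `z` alone distinguishes the adjacent vertices `x` and `y`. If an outside vertex
other than these two has a neighbour in `{k₁, k₂}`, it separates `k₁` from `k₂`, and `{k₁, k₂, x,
y}` works. Otherwise `z` sees neither `k₁` nor `k₂` while `y` sees one of them, and `{k₁, k₂, x, z}`
works with `y` as separator. Edges from the clique to outside vertices are separated by spare twins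
of `k₁` and `k₂`. -/
theorem exists_resolved_of_pair (hG : G.Connected) (h : IsTwoClassClique G K k₁ k₂) {k₁' : V}
    (hk₁' : k₁' ∈ K) (hne' : k₁' ≠ k₁) (ht' : ClosedTwin G k₁ k₁') {x y z : V}
    (hx : x ∉ K) (hy : y ∉ K) (hz : z ∉ K) (hxy : G.Adj x y)
    (hpair : ∀ w, w ≠ x → w ≠ y → w ≠ z → (G.Adj x w ↔ G.Adj y w))
    (hxz : G.Adj x z) (hyz : ¬G.Adj y z) (nyz : y ≠ z) :
    ∃ S : Finset V, S.card = 4 ∧ ResolvedFromOutside G S := by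
  have hK : ∀ k ∈ K, ∀ t ∉ K, k ≠ t := by rintro k hk t ht rfl; exact ht hk
  have hx1 : G.Adj k₁ x ↔ G.Adj k₁ y := by
    rw [G.adj_comm, G.adj_comm k₁]
    exact hpair _ (hK _ h.mem₁ _ hx) (hK _ h.mem₁ _ hy) (hK _ h.mem₁ _ hz)
  have hx2 : G.Adj k₂ x ↔ G.Adj k₂ y := by
    rw [G.adj_comm, G.adj_comm k₂]
    exact hpair _ (hK _ h.mem₂ _ hx) (hK _ h.mem₂ _ hy) (hK _ h.mem₂ _ hz)
  have hk₁'2 : k₁' ≠ k₂ := by rintro rfl; exact h.not_twin ht'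
  have s1 : ∀ p ∉ K, ∀ q ∉ K, G.Adj k₁ p → G.Adj k₁ x → SepAvoiding G k₁ k₂ p q k₁ p := by
    intro p hp q hq h1p h1x
    rcases h.exists_twin_or with ⟨l, hl, hl2, hl'⟩ | h'
    · have hl1 : l ≠ k₁ := by rintro rfl; exact h.not_twin hl'.symm
      refine .of_adj l ⟨hl1, hl2, hK l hl p hp, hK l hl q hq⟩ fun hiff => ?_
      have := hiff.1 (h.isMaximumClique.isClique h.mem₁ hl hl1.symm)
      exact h.not_adj_both hp ⟨h1p, (h.adj_iff h.mem₂ hl hp hl').2 this.symm⟩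
    · exact absurd ⟨h1x, hx1.1 h1x⟩ (h' x hx y hy hxy)
  have s2 : ∀ p ∉ K, ∀ q ∉ K, SepAvoiding G k₁ k₂ p q k₂ p := by
    intro p hp q hq h2p
    refine (SepAvoiding.of_adj k₁' ⟨hne', hk₁'2, hK _ hk₁' _ hp, hK _ hk₁' _ hq⟩
      fun hiff => ?_ : SepAvoiding G k₁ k₂ p q k₂ p) h2p
    have := hiff.1 (h.isMaximumClique.isClique h.mem₂ hk₁' hk₁'2.symm)
    exact h.not_adj_both hp ⟨(h.adj_iff h.mem₁ hk₁' hp ht').2 this.symm, h2p⟩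
  have swap : ∀ {p q u v}, SepAvoiding G k₁ k₂ p q u v → SepAvoiding G k₁ k₂ q p u v := by
    intro p q u v hs huv
    obtain ⟨w, ⟨h1, h2, h3, h4⟩, hd⟩ := hs huv
    exact ⟨w, ⟨h1, h2, h4, h3⟩, hd⟩
  have s12 : ∀ w ∉ K, (G.Adj k₁ w ∨ G.Adj k₂ w) → ¬(G.Adj k₁ w ↔ G.Adj k₂ w) := by
    intro w hw hor
    have := h.not_adj_both hw
    tauto
  by_cases hw : ∃ w ∉ K, (w ≠ x ∧ w ≠ y) ∧ (G.Adj k₁ w ∨ G.Adj k₂ w)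
  · obtain ⟨w, hwK, ⟨hwx, hwy⟩, hor⟩ := hw
    refine exists_resolvedFromOutside_of_sepAvoiding h.ne (hK _ h.mem₁ _ hx) (hK _ h.mem₁ _ hy)
      (hK _ h.mem₂ _ hx) (hK _ h.mem₂ _ hy) hxy.ne
      (.of_adj w ⟨(hK _ h.mem₁ _ hwK).symm, (hK _ h.mem₂ _ hwK).symm, hwx, hwy⟩ (s12 w hwK hor))
      (fun h1x => s1 x hx y hy h1x h1x h1x)
      (fun h1y => swap (s1 y hy x hx h1y (hx1.2 h1y)) h1y)
      (s2 x hx y hy) (swap (s2 y hy x hx))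
      (.of_adj z ⟨(hK _ h.mem₁ _ hz).symm, (hK _ h.mem₂ _ hz).symm, hxz.ne', nyz.symm⟩ ?_)
    intro hiff
    exact hyz (hiff.1 hxz)
  · push Not at hw
    have hz12 := hw z hz ⟨hxz.ne', nyz.symm⟩
    obtain ⟨t, htK, ht⟩ := h.exists_adj hG hx
    have hy12 : G.Adj k₁ y ∨ G.Adj k₂ y := by
      by_cases htx : t = x
      · subst htx; rwa [← hx1, ← hx2]
      · by_cases hty : t = y
        · rwa [← hty]
        · have := hw t htK ⟨htx, hty⟩
          tauto
    refine exists_resolvedFromOutside_of_sepAvoiding h.ne (hK _ h.mem₁ _ hx) (hK _ h.mem₁ _ hz)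
      (hK _ h.mem₂ _ hx) (hK _ h.mem₂ _ hz) hxz.ne
      (.of_adj y ⟨(hK _ h.mem₁ _ hy).symm, (hK _ h.mem₂ _ hy).symm, hxy.ne', nyz⟩ (s12 y hy hy12))
      (fun h1x => s1 x hx z hz h1x h1x h1x)
      (.of_not_adj hz12.1) (s2 x hx z hz) (.of_not_adj hz12.2)
      (.of_adj y ⟨(hK _ h.mem₁ _ hy).symm, (hK _ h.mem₂ _ hy).symm, hxy.ne', nyz⟩ ?_)
    intro hiff
    exact hyz (hiff.1 hxy).symm

/-- The set is `{k₁, x, y, z}`: `k₂` separates `k₁` from its outside neighbours, and a separator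
equal to `k₁` is replaced by its twin `k₁'`. It could only fail if one of `x`, `y`, `z` were the
sole separator of the other two, which is `exists_resolved_of_pair`. -/
theorem exists_resolved_of_three_outside (hG : G.Connected) (h : IsTwoClassClique G K k₁ k₂)
    {k₁' : V} (hk₁' : k₁' ∈ K) (hne' : k₁' ≠ k₁) (ht' : ClosedTwin G k₁ k₁') {x y z : V}
    (hx : x ∉ K) (hy : y ∉ K) (hz : z ∉ K) (hxy : ¬ClosedTwin G x y) (hxz : ¬ClosedTwin G x z)
    (hyz : ¬ClosedTwin G y z) :
    ∃ S : Finset V, S.card = 4 ∧ ResolvedFromOutside G S := by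
  by_contra hbad
  have hK : ∀ k ∈ K, ∀ t ∉ K, k ≠ t := by rintro k hk t ht rfl; exact ht hk
  have hne : ∀ {u v : V}, ¬ClosedTwin G u v → u ≠ v := by
    rintro u v h rfl; exact h (ClosedTwin.refl _)
  have key : ∀ {p q r : V}, p ∉ K → q ∉ K → r ∉ K → ¬ClosedTwin G p q → G.Adj p q →
      ∃ w, (w ≠ p ∧ w ≠ q ∧ w ≠ r) ∧ ¬(G.Adj p w ↔ G.Adj q w) := by
    intro p q r hp hq hr hpq hadj
    by_contra hc
    have hall : ∀ w, w ≠ p → w ≠ q → w ≠ r → (G.Adj p w ↔ G.Adj q w) := fun w h1 h2 h3 => by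
      by_contra h4; exact hc ⟨w, ⟨h1, h2, h3⟩, h4⟩
    obtain ⟨w, hpw, hqw, hw⟩ := exists_adj_not_iff hadj hpq
    obtain rfl : w = r := by
      by_contra hwr; exact hw (hall w hpw.symm hqw.symm hwr)
    by_cases h1 : G.Adj p w
    · exact hbad (h.exists_resolved_of_pair hG hk₁' hne' ht' hp hq hr hadj hall h1 (by tauto) hqw)
    · exact hbad (h.exists_resolved_of_pair hG hk₁' hne' ht' hq hp hr hadj.symm
        (fun w h1 h2 h3 => (hall w h2 h1 h3).symm) (by tauto) h1 hpw)
  have sep : ∀ {p q r : V}, p ∉ K → q ∉ K → r ∉ K → ¬ClosedTwin G p q → G.Adj p q →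
      ∃ w, (w ≠ k₁ ∧ w ≠ p ∧ w ≠ q ∧ w ≠ r) ∧ G.dist p w ≠ G.dist q w := by
    intro p q r hp hq hr hpq hadj
    obtain ⟨w, ⟨h1, h2, h3⟩, h4⟩ := key hp hq hr hpq hadj
    by_cases hw : w = k₁
    · subst hw
      refine ⟨k₁', ⟨hne', hK _ hk₁' _ hp, hK _ hk₁' _ hq, hK _ hk₁' _ hr⟩,
        dist_ne_of_not_adj_iff ?_⟩
      rwa [G.adj_comm, ← h.adj_iff h.mem₁ hk₁' hp ht', G.adj_comm q,
        ← h.adj_iff h.mem₁ hk₁' hq ht', G.adj_comm w, G.adj_comm w]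
    · exact ⟨w, ⟨hw, h1, h2, h3⟩, dist_ne_of_not_adj_iff h4⟩
  have s1 : ∀ {p}, p ∉ K → SepAvoiding G k₁ x y z k₁ p := by
    intro p hp h1p
    refine ⟨k₂, ⟨h.ne.symm, hK _ h.mem₂ _ hx, hK _ h.mem₂ _ hy, hK _ h.mem₂ _ hz⟩,
      dist_ne_of_not_adj_iff fun hiff => ?_⟩
    exact h.not_adj_both hp ⟨h1p, (hiff.1 h.adj).symm⟩
  refine hbad (exists_resolvedFromOutside_of_sepAvoiding (hK _ h.mem₁ _ hx) (hK _ h.mem₁ _ hy)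
    (hK _ h.mem₁ _ hz) (hne hxy) (hne hxz) (hne hyz) (s1 hx) (s1 hy) (s1 hz)
    (fun hadj => sep hx hy hz hxy hadj) (fun hadj => ?_) (fun hadj => ?_))
  · obtain ⟨w, ⟨h1, h2, h3, h4⟩, hd⟩ := sep hx hz hy hxz hadj
    exact ⟨w, ⟨h1, h2, h4, h3⟩, hd⟩
  · obtain ⟨w, ⟨h1, h2, h3, h4⟩, hd⟩ := sep hy hz hx hyz hadj
    exact ⟨w, ⟨h1, h4, h2, h3⟩, hd⟩

/-- The outside vertices form a clique joined completely to the class of `k₁` and not at all to the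
class `A` of `k₂` in `K`. So the non-edges are exactly the pairs between `A` and `Kᶜ`. -/
theorem nonempty_iso_of_one_outside [Fintype V] (h : IsTwoClassClique G K k₁ k₂)
    (hX : K.card + 3 ≤ Fintype.card V) {y : V} (hy : y ∉ K) (hy1 : G.Adj k₁ y)
    (hcov : ∀ t ∉ K, ClosedTwin G y t) :
    ∃ a b : ℕ, 2 ≤ b ∧ b ≤ a ∧ a + b < Fintype.card V ∧
      Nonempty (G ≃g completeMinusBipartite (Fintype.card V) a b) := by
  classical
  have hK : ∀ k ∈ K, ∀ t ∉ K, k ≠ t := by rintro k hk t ht rfl; exact ht hk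
  have hout : ∀ k ∈ K, ∀ t ∉ K, (G.Adj k y ↔ G.Adj k t) := by
    intro k hk t ht
    rw [G.adj_comm, (hcov t ht).adj_iff (hK k hk y hy).symm (hK k hk t ht).symm, G.adj_comm]
  have h1 : ∀ l ∈ K, ∀ t ∉ K, ClosedTwin G k₁ l → G.Adj l t := fun l hl t ht hl' =>
    (h.adj_iff h.mem₁ hl ht hl').1 ((hout _ h.mem₁ t ht).1 hy1)
  have h2 : ∀ l ∈ K, ∀ t ∉ K, ClosedTwin G k₂ l → ¬G.Adj l t := fun l hl t ht hl' hadj =>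
    h.not_adj_both ht ⟨(hout _ h.mem₁ t ht).1 hy1, (h.adj_iff h.mem₂ hl ht hl').2 hadj⟩
  have h12 : ∀ l ∈ K, ClosedTwin G k₂ l → ¬ClosedTwin G k₁ l := fun l _ h2' h1' =>
    h.not_twin (h1'.trans h2'.symm)
  have hXX : ∀ s ∉ K, ∀ t ∉ K, s ≠ t → G.Adj s t := fun s hs t ht hst =>
    ((hcov s hs).symm.trans (hcov t ht)).adj hst
  set A := K.filter fun l => ClosedTwin G k₂ l
  have hAB : Disjoint A Kᶜ := by
    rw [Finset.disjoint_left]; intro l hl; simp [(Finset.mem_filter.1 hl).1]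
  -- Replacing `A` by `Kᶜ` in `K` gives another clique, so maximality orders the two parts.
  have hBA : Kᶜ.card ≤ A.card := by
    refine card_le_of_exchange h.isMaximumClique ?_ (by simp) ?_
    · intro s hs t ht hst
      exact hXX s (by simpa using hs) t (by simpa using ht) hst
    · intro t ht l hl hlA
      refine (h1 l hl t (by simpa using ht) ((h.cover l hl).resolve_right fun h' => hlA ?_)).symm
      exact Finset.mem_filter.2 ⟨hl, h'⟩
  have hc := Finset.card_compl K
  have hAK : A.card < K.card := Finset.card_lt_card <| by
    refine Finset.filter_ssubset.2 ⟨k₁, h.mem₁, fun h' => h.not_twin h'.symm⟩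
  refine ⟨A.card, Kᶜ.card, by omega, hBA, by omega, nonempty_iso_completeMinusBipartite hAB ?_⟩
  intro u v
  simp only [A, Finset.mem_filter, Finset.mem_compl]
  by_cases hu : u ∈ K <;> by_cases hv : v ∈ K
  · have := h.isMaximumClique.isClique (Finset.mem_coe.2 hu) (Finset.mem_coe.2 hv)
    exact ⟨fun h' => ⟨h'.ne, by tauto, by tauto⟩, fun h' => this h'.1⟩
  · have e1 := h1 u hu v hv
    have e2 := h2 u hu v hv
    have e3 := h.cover u hu
    have e4 := hK u hu v hv
    tauto
  · have e1 := h1 v hv u hu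
    have e2 := h2 v hv u hu
    have e3 := h.cover v hv
    have e4 := (hK v hv u hu).symm
    rw [G.adj_comm]
    tauto
  · have := hXX u hu v hv
    exact ⟨fun h' => ⟨h'.ne, by tauto, by tauto⟩, fun h' => this h'.1⟩

end IsTwoClassClique

end TwoClasses

/-! ### Two classes inside the clique and two outside -/

section TwoOutsideClasses

theorem ClosedTwin.not_symm {V : Type*} {G : SimpleGraph V} {u v : V} (h : ¬ClosedTwin G u v) :
    ¬ClosedTwin G v u := fun h' => h h'.symm

theorem ClosedTwin.ne_of_not {V : Type*} {G : SimpleGraph V} {u v : V} (h : ¬ClosedTwin G u v) :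
    u ≠ v := by
  rintro rfl; exact h (ClosedTwin.refl _)

/-- Vertices `u` and `v` have different distances to a twin of a vertex `p` adjacent
to `u` but not to `v`. -/
theorem dist_ne_of_twin {V : Type*} {G : SimpleGraph V} {u v p w : V}
    (hup : ¬ClosedTwin G u p) (hvp : ¬ClosedTwin G v p)
    (hpw : ClosedTwin G p w) (hu : G.Adj u p) (hv : ¬G.Adj v p) : G.dist u w ≠ G.dist v w :=
  dist_ne_of_not_adj_iff fun h => hv <|
    ((ClosedTwin.refl v).adj_congr hpw hvp).2 (h.1 (((ClosedTwin.refl u).adj_congr hpw hup).1 hu))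

/-- If the quotient of `G` contains the path `a`, `b`, `p`, and `a'` is neither adjacent to `b` nor
to `p`, while the fourth class does not join `a'` to `p`, then twins of `p` distinguish `a`
from `a'`. -/
theorem dist_ne_of_path {V : Type*} {G : SimpleGraph V} (hG : G.Connected) {a a' b p w : V}
    (hbp : ¬ClosedTwin G b p) (hap : ¬ClosedTwin G a p) (ha'p : ¬ClosedTwin G a' p)
    (ha'b : ¬ClosedTwin G a' b) (ha'a : ¬ClosedTwin G a' a)
    (hcov : ∀ w, ClosedTwin G a w ∨ ClosedTwin G a' w ∨ ClosedTwin G b w ∨ ClosedTwin G p w)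
    (hpw : ClosedTwin G p w) (h1 : G.Adj a b) (h2 : G.Adj b p)
    (h3 : ¬G.Adj a' b) (h4 : ¬G.Adj a' p) (h5 : ¬G.Adj a p ∨ ¬G.Adj a' a) :
    G.dist a w ≠ G.dist a' w := by
  refine dist_ne_of_common_neighbor hG h1 (((ClosedTwin.refl b).adj_congr hpw hbp).1 h2) ?_
    (fun h => h4 (((ClosedTwin.refl a').adj_congr hpw ha'p).2 h)) ?_
  · rintro rfl; exact ha'p hpw.symm
  · intro v hv1 hv2
    rcases hcov v with hv | hv | hv | hv
    · exact h5.elim (fun h5 => h5 ((hv.adj_congr hpw hap).2 hv2))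
        (fun h5 => h5 (((ClosedTwin.refl a').adj_congr hv ha'a).2 hv1))
    · exact h4 ((hv.adj_congr hpw ha'p).2 hv2)
    · exact h3 (((ClosedTwin.refl a').adj_congr hv ha'b).2 hv1)
    · exact h4 (((ClosedTwin.refl a').adj_congr hv ha'p).2 hv1)

variable {V : Type*} [Finite V] {G : SimpleGraph V} {K : Finset V} {k₁ k₂ : V}

namespace IsTwoClassClique

theorem not_closedTwin_outside (h : IsTwoClassClique G K k₁ k₂) {t : V} (ht : t ∉ K) :
    ¬ClosedTwin G k₁ t := by
  intro h'
  have h1 : k₁ ≠ t := by rintro rfl; exact ht h.mem₁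
  have h2 : k₂ ≠ t := by rintro rfl; exact ht h.mem₂
  exact h.not_adj_both ht ⟨h'.adj h1, ((h'.adj_iff h.ne h2.symm).1 h.adj).symm⟩

theorem exists_twin_of_adj (h : IsTwoClassClique G K k₁ k₂) {y t : V} (hy : y ∉ K) (ht : t ∉ K)
    (hne : t ≠ y) (hyt : ClosedTwin G y t) (h1 : G.Adj k₁ y) :
    ∃ l ∈ K, l ≠ k₂ ∧ ClosedTwin G k₂ l := by
  refine h.exists_twin_or.resolve_right fun h' => ?_
  refine h' y hy t ht (hyt.adj hne.symm) ⟨h1, ?_⟩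
  exact ((ClosedTwin.refl k₁).adj_congr hyt (h.not_closedTwin_outside hy)).1 h1

/-- The vertices outside the clique form two further classes, with representatives `y`, `z`. -/
structure HasTwoOutsideClasses (G : SimpleGraph V) (K : Finset V) (k₁ k₂ y z : V) : Prop extends
    IsTwoClassClique G K k₁ k₂ where
  notMem₁ : y ∉ K
  notMem₂ : z ∉ K
  not_twin_outside : ¬ClosedTwin G y z
  cover_outside : ∀ t ∉ K, ClosedTwin G y t ∨ ClosedTwin G z t

namespace HasTwoOutsideClasses

variable {y z : V}

theorem swap_outside (h : HasTwoOutsideClasses G K k₁ k₂ y z) :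
    HasTwoOutsideClasses G K k₁ k₂ z y :=
  ⟨h.toIsTwoClassClique, h.notMem₂, h.notMem₁, ClosedTwin.not_symm h.not_twin_outside,
    fun t ht => (h.cover_outside t ht).symm⟩

theorem swap_inside (h : HasTwoOutsideClasses G K k₁ k₂ y z) :
    HasTwoOutsideClasses G K k₂ k₁ y z :=
  ⟨h.toIsTwoClassClique.symm, h.notMem₁, h.notMem₂, h.not_twin_outside, h.cover_outside⟩

theorem cover_all (h : HasTwoOutsideClasses G K k₁ k₂ y z) (w : V) :
    ClosedTwin G k₁ w ∨ ClosedTwin G k₂ w ∨ ClosedTwin G y w ∨ ClosedTwin G z w := by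
  by_cases hw : w ∈ K
  · exact (h.cover w hw).imp_right Or.inl
  · exact Or.inr (Or.inr (h.cover_outside w hw))

theorem not_twin₁₁ (h : HasTwoOutsideClasses G K k₁ k₂ y z) : ¬ClosedTwin G k₁ y :=
  h.not_closedTwin_outside h.notMem₁

theorem not_twin₁₂ (h : HasTwoOutsideClasses G K k₁ k₂ y z) : ¬ClosedTwin G k₁ z :=
  h.not_closedTwin_outside h.notMem₂

theorem not_twin₂₁ (h : HasTwoOutsideClasses G K k₁ k₂ y z) : ¬ClosedTwin G k₂ y :=
  h.swap_inside.not_twin₁₁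

theorem not_twin₂₂ (h : HasTwoOutsideClasses G K k₁ k₂ y z) : ¬ClosedTwin G k₂ z :=
  h.swap_inside.not_twin₁₂

/-- It suffices to distinguish adjacent representatives by further vertices. -/
theorem exists_resolved (h : HasTwoOutsideClasses G K k₁ k₂ y z)
    (s12 : ∃ w, (w ≠ k₁ ∧ w ≠ k₂ ∧ w ≠ y ∧ w ≠ z) ∧ G.dist k₁ w ≠ G.dist k₂ w)
    (s1y : SepAvoiding G k₁ k₂ y z k₁ y) (s1z : SepAvoiding G k₁ k₂ y z k₁ z)
    (s2y : SepAvoiding G k₁ k₂ y z k₂ y) (s2z : SepAvoiding G k₁ k₂ y z k₂ z)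
    (syz : SepAvoiding G k₁ k₂ y z y z) :
    ∃ S : Finset V, S.card = 4 ∧ ResolvedFromOutside G S :=
  exists_resolvedFromOutside_of_sepAvoiding h.ne (ClosedTwin.ne_of_not h.not_twin₁₁)
    (ClosedTwin.ne_of_not h.not_twin₁₂) (ClosedTwin.ne_of_not h.not_twin₂₁)
    (ClosedTwin.ne_of_not h.not_twin₂₂) (ClosedTwin.ne_of_not h.not_twin_outside)
    (fun _ => s12) s1y s1z s2y s2z syz

theorem avoid_of_mem (h : HasTwoOutsideClasses G K k₁ k₂ y z) {l : V} (hl : l ∈ K)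
    (h1 : l ≠ k₁) (h2 : l ≠ k₂) : l ≠ k₁ ∧ l ≠ k₂ ∧ l ≠ y ∧ l ≠ z :=
  ⟨h1, h2, by rintro rfl; exact h.notMem₁ hl, by rintro rfl; exact h.notMem₂ hl⟩

theorem avoid_of_notMem (h : HasTwoOutsideClasses G K k₁ k₂ y z) {t : V} (ht : t ∉ K)
    (h1 : t ≠ y) (h2 : t ≠ z) : t ≠ k₁ ∧ t ≠ k₂ ∧ t ≠ y ∧ t ≠ z :=
  ⟨by rintro rfl; exact ht h.mem₁, by rintro rfl; exact ht h.mem₂, h1, h2⟩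

/-- The quotient is a star centred at `k₁`. The spare outside vertex `t` separates `k₁` from `k₂`,
and a spare twin of `k₂` separates `k₁` from `y` and `z`. -/
theorem exists_resolved_same (h : HasTwoOutsideClasses G K k₁ k₂ y z) {t : V} (ht : t ∉ K)
    (hty : t ≠ y) (htz : t ≠ z) (h1y : G.Adj k₁ y) (h1z : G.Adj k₁ z) :
    ∃ S : Finset V, S.card = 4 ∧ ResolvedFromOutside G S := by
  have h2y : ¬G.Adj k₂ y := fun h' => h.not_adj_both h.notMem₁ ⟨h1y, h'⟩
  have h2z : ¬G.Adj k₂ z := fun h' => h.not_adj_both h.notMem₂ ⟨h1z, h'⟩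
  -- If adjacent, `y` and `z` would see all four classes alike and be twins.
  have nyz : ¬G.Adj y z := by
    intro hyz
    obtain ⟨w, hyw, hzw, hw⟩ := exists_adj_not_iff hyz h.not_twin_outside
    have c : ∀ {p u v : V}, ClosedTwin G u v → ¬ClosedTwin G p u → (G.Adj p u ↔ G.Adj p v) :=
      fun hv hn => (ClosedTwin.refl _).adj_congr hv hn
    rcases h.cover_all w with h' | h' | h' | h'
    · have e1 := c h' (ClosedTwin.not_symm h.not_twin₁₁)
      have e2 := c h' (ClosedTwin.not_symm h.not_twin₁₂)
      exact hw (by rw [← e1, ← e2]; exact ⟨fun _ => h1z.symm, fun _ => h1y.symm⟩)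
    · have e1 := c h' (ClosedTwin.not_symm h.not_twin₂₁)
      have e2 := c h' (ClosedTwin.not_symm h.not_twin₂₂)
      rw [← e1, ← e2, G.adj_comm, G.adj_comm z] at hw
      tauto
    · have e1 := c h' (ClosedTwin.not_symm h.not_twin_outside)
      exact hw ⟨fun _ => e1.1 hyz.symm, fun _ => h'.adj hyw⟩
    · have e1 := c h' h.not_twin_outside
      exact hw ⟨fun _ => h'.adj hzw, fun _ => e1.1 hyz⟩
  obtain ⟨l, hl, hl2, hl'⟩ : ∃ l ∈ K, l ≠ k₂ ∧ ClosedTwin G k₂ l := by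
    rcases h.cover_outside t ht with h' | h'
    · exact h.exists_twin_of_adj h.notMem₁ ht hty h' h1y
    · exact h.exists_twin_of_adj h.notMem₂ ht htz h' h1z
  have hl1 : l ≠ k₁ := by rintro rfl; exact h.not_twin hl'.symm
  refine h.exists_resolved ⟨t, h.avoid_of_notMem ht hty htz, ?_⟩
    (fun _ => ⟨l, h.avoid_of_mem hl hl1 hl2, ?_⟩) (fun _ => ⟨l, h.avoid_of_mem hl hl1 hl2, ?_⟩)
    (.of_not_adj h2y) (.of_not_adj h2z) (.of_not_adj nyz)
  · rcases h.cover_outside t ht with h' | h'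
    · exact dist_ne_of_twin h.not_twin₁₁ h.not_twin₂₁ h' h1y h2y
    · exact dist_ne_of_twin h.not_twin₁₂ h.not_twin₂₂ h' h1z h2z
  · exact dist_ne_of_twin h.not_twin (ClosedTwin.not_symm h.not_twin₂₁) hl' h.adj
      fun h' => h2y h'.symm
  · exact dist_ne_of_twin h.not_twin (ClosedTwin.not_symm h.not_twin₂₂) hl' h.adj
      fun h' => h2z h'.symm

/-- The quotient is the path `y k₁ k₂ z`, possibly closed to a 4-cycle. A twin `t` of `y` forces a
spare twin `l` of `k₂`. Then `t` separates `k₁k₂` and `k₂z`, the latter by distance if `y` and `z`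
are not adjacent, and `l` separates `k₁y` and `yz`. -/
theorem exists_resolved_opposite_of_twin (hG : G.Connected)
    (h : HasTwoOutsideClasses G K k₁ k₂ y z) {t : V} (ht : t ∉ K) (hty : t ≠ y)
    (h' : ClosedTwin G y t) (h1y : G.Adj k₁ y) (h2z : G.Adj k₂ z) :
    ∃ S : Finset V, S.card = 4 ∧ ResolvedFromOutside G S := by
  have htz : t ≠ z := by rintro rfl; exact h.not_twin_outside h'
  have h2y : ¬G.Adj k₂ y := fun h' => h.not_adj_both h.notMem₁ ⟨h1y, h'⟩
  have h1z : ¬G.Adj k₁ z := fun h' => h.not_adj_both h.notMem₂ ⟨h', h2z⟩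
  obtain ⟨l, hl, hl2, hl'⟩ := h.exists_twin_of_adj h.notMem₁ ht hty h' h1y
  have hl1 : l ≠ k₁ := by rintro rfl; exact h.not_twin hl'.symm
  refine h.exists_resolved ⟨t, h.avoid_of_notMem ht hty htz, ?_⟩
    (fun _ => ⟨l, h.avoid_of_mem hl hl1 hl2, ?_⟩) (.of_not_adj h1z) (.of_not_adj h2y)
    (fun _ => ⟨t, h.avoid_of_notMem ht hty htz, ?_⟩) (fun _ => ⟨l, h.avoid_of_mem hl hl1 hl2, ?_⟩)
  · exact dist_ne_of_twin h.not_twin₁₁ h.not_twin₂₁ h' h1y h2y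
  · exact dist_ne_of_twin h.not_twin (ClosedTwin.not_symm h.not_twin₂₁) hl' h.adj
      fun h' => h2y h'.symm
  · by_cases hyz : G.Adj y z
    · exact (dist_ne_of_twin (ClosedTwin.not_symm h.not_twin_outside) h.not_twin₂₁ h' hyz.symm
        h2y).symm
    · exact dist_ne_of_path hG (b := k₁) h.not_twin₁₁ h.not_twin₂₁
        (ClosedTwin.not_symm h.not_twin_outside) (ClosedTwin.not_symm h.not_twin₁₂)
        (ClosedTwin.not_symm h.not_twin₂₂) (fun w => by have := h.cover_all w; tauto) h'
        h.adj.symm h1y (fun h' => h1z h'.symm) (fun h' => hyz h'.symm) (Or.inl h2y)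
  · exact (dist_ne_of_twin (ClosedTwin.not_symm h.not_twin₂₂) (ClosedTwin.not_symm h.not_twin₂₁)
      hl' h2z.symm fun h' => h2y h'.symm).symm

theorem exists_resolved_opposite (hG : G.Connected) (h : HasTwoOutsideClasses G K k₁ k₂ y z)
    {t : V} (ht : t ∉ K) (hty : t ≠ y) (htz : t ≠ z) (h1y : G.Adj k₁ y) (h2z : G.Adj k₂ z) :
    ∃ S : Finset V, S.card = 4 ∧ ResolvedFromOutside G S := by
  rcases h.cover_outside t ht with h' | h'
  · exact h.exists_resolved_opposite_of_twin hG ht hty h' h1y h2z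
  · exact h.swap_inside.swap_outside.exists_resolved_opposite_of_twin hG ht htz h' h2z h1y

/-- The quotient is the path `k₂ k₁ y z`. Where a spare vertex does not separate an edge by
adjacency, distances 2 and at least 3 along the path do. -/
theorem exists_resolved_path (hG : G.Connected) (h : HasTwoOutsideClasses G K k₁ k₂ y z)
    {t l : V} (ht : t ∉ K) (hty : t ≠ y) (htz : t ≠ z) (hl : l ∈ K) (hl1 : l ≠ k₁) (hl2 : l ≠ k₂)
    (h1y : G.Adj k₁ y) (h1z : ¬G.Adj k₁ z) (h2z : ¬G.Adj k₂ z) :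
    ∃ S : Finset V, S.card = 4 ∧ ResolvedFromOutside G S := by
  have h2y : ¬G.Adj k₂ y := fun h' => h.not_adj_both h.notMem₁ ⟨h1y, h'⟩
  -- By connectedness some edge leaves the class of `z`, and only the class of `y` can receive it.
  have hyz : G.Adj y z := by
    by_contra hyz
    obtain ⟨a, ha, b, hb, hab⟩ := exists_adj_boundary hG (A := {w | ClosedTwin G z w})
      (u := z) (v := y) (ClosedTwin.refl z) (ClosedTwin.not_symm h.not_twin_outside)
    change ClosedTwin G z a at ha
    change ¬ClosedTwin G z b at hb
    rcases h.cover_all b with h' | h' | h' | h'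
    · exact h1z ((h'.adj_congr ha h.not_twin₁₂).2 hab.symm)
    · exact h2z ((h'.adj_congr ha h.not_twin₂₂).2 hab.symm)
    · exact hyz ((h'.adj_congr ha h.not_twin_outside).2 hab.symm)
    · exact hb h'
  have avt := h.avoid_of_notMem ht hty htz
  refine h.exists_resolved ⟨t, avt, ?_⟩ (fun _ => ?_) (.of_not_adj h1z) (.of_not_adj h2y)
    (.of_not_adj h2z) (fun _ => ⟨l, h.avoid_of_mem hl hl1 hl2, ?_⟩)
  · rcases h.cover_outside t ht with h' | h'
    · exact dist_ne_of_twin h.not_twin₁₁ h.not_twin₂₁ h' h1y h2y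
    · exact dist_ne_of_path hG (b := y) h.not_twin_outside h.not_twin₁₂ h.not_twin₂₂ h.not_twin₂₁
        (ClosedTwin.not_symm h.not_twin) (fun w => by have := h.cover_all w; tauto) h'
        h1y hyz h2y h2z (Or.inl h1z)
  · rcases h.cover_outside t ht with h' | h'
    · obtain ⟨l, hl, hl2, hl'⟩ := h.exists_twin_of_adj h.notMem₁ ht hty h' h1y
      have hl1 : l ≠ k₁ := by rintro rfl; exact h.not_twin hl'.symm
      exact ⟨l, h.avoid_of_mem hl hl1 hl2, dist_ne_of_twin h.not_twin
        (ClosedTwin.not_symm h.not_twin₂₁) hl' h.adj fun h' => h2y h'.symm⟩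
    · exact ⟨t, avt, (dist_ne_of_twin h.not_twin_outside h.not_twin₁₂ h' hyz h1z).symm⟩
  · rcases h.cover l hl with h' | h'
    · exact dist_ne_of_twin (ClosedTwin.not_symm h.not_twin₁₁) (ClosedTwin.not_symm h.not_twin₁₂)
        h' h1y.symm fun h' => h1z h'.symm
    · exact dist_ne_of_path hG (b := k₁) h.not_twin (ClosedTwin.not_symm h.not_twin₂₁)
        (ClosedTwin.not_symm h.not_twin₂₂) (ClosedTwin.not_symm h.not_twin₁₂)
        (ClosedTwin.not_symm h.not_twin_outside) (fun w => by have := h.cover_all w; tauto) h'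
        h1y.symm h.adj (fun h' => h1z h'.symm) (fun h' => h2z h'.symm) (Or.inl fun h' => h2y h'.symm)

theorem exists_resolved_of_card (hG : G.Connected) (h : HasTwoOutsideClasses G K k₁ k₂ y z)
    {t l : V} (ht : t ∉ K) (hty : t ≠ y) (htz : t ≠ z) (hl : l ∈ K) (hl1 : l ≠ k₁) (hl2 : l ≠ k₂) :
    ∃ S : Finset V, S.card = 4 ∧ ResolvedFromOutside G S := by
  by_cases h1y : G.Adj k₁ y <;> by_cases h1z : G.Adj k₁ z <;> by_cases h2y : G.Adj k₂ y <;>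
    by_cases h2z : G.Adj k₂ z
  all_goals first
    | exact h.exists_resolved_same ht hty htz h1y h1z
    | exact h.swap_inside.exists_resolved_same ht hty htz h2y h2z
    | exact h.exists_resolved_opposite hG ht hty htz h1y h2z
    | exact h.swap_outside.exists_resolved_opposite hG ht htz hty h1z h2y
    | exact h.exists_resolved_path hG ht hty htz hl hl1 hl2 h1y h1z h2z
    | exact h.swap_outside.exists_resolved_path hG ht htz hty hl hl1 hl2 h1z h1y h2y
    | exact h.swap_inside.exists_resolved_path hG ht hty htz hl hl2 hl1 h2y h2z h1z
    | exact h.swap_outside.swap_inside.exists_resolved_path hG ht htz hty hl hl2 hl1 h2z h2y h1y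
    | skip
  -- The pattern left over has no edge between `K` and the outside, which connectedness forbids.
  obtain ⟨s, hs, hs'⟩ := h.toIsTwoClassClique.exists_adj hG h.notMem₁
  have c1 : ∀ {p u : V}, ClosedTwin G u s → ¬ClosedTwin G p u → (G.Adj p u ↔ G.Adj p s) :=
    fun hv hn => (ClosedTwin.refl _).adj_congr hv hn
  rcases h.cover_outside s hs with h' | h'
  · rw [← c1 h' h.not_twin₁₁, ← c1 h' h.not_twin₂₁] at hs'
    tauto
  · rw [← c1 h' h.not_twin₁₂, ← c1 h' h.not_twin₂₂] at hs'
    tauto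

end HasTwoOutsideClasses

theorem exists_resolved_or_iso [Fintype V] (hG : G.Connected) (h : IsTwoClassClique G K k₁ k₂)
    (hX : K.card + 3 ≤ Fintype.card V) (hK3 : 3 ≤ K.card) :
    (∃ S : Finset V, S.card = 4 ∧ ResolvedFromOutside G S) ∨
      ∃ a b : ℕ, 2 ≤ b ∧ b ≤ a ∧ a + b < Fintype.card V ∧
        Nonempty (G ≃g completeMinusBipartite (Fintype.card V) a b) := by
  classical
  obtain ⟨l, hlK, hl⟩ : ∃ l ∈ K, l ∉ ({k₁, k₂} : Finset V) :=
    Finset.exists_mem_notMem_of_card_lt_card (lt_of_le_of_lt Finset.card_le_two hK3)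
  simp only [Finset.mem_insert, Finset.mem_singleton, not_or] at hl
  have hXc : 3 ≤ Kᶜ.card := by rw [Finset.card_compl]; omega
  obtain ⟨y, hy⟩ := Finset.card_pos.1 (by omega : 0 < Kᶜ.card)
  rw [Finset.mem_compl] at hy
  by_cases hone : ∀ t ∉ K, ClosedTwin G y t
  · right
    -- All outside vertices are twins, so one adjacent to `k₁` or `k₂` can serve as representative.
    obtain ⟨s, hs, hs'⟩ := h.exists_adj hG hy
    have hone' : ∀ t ∉ K, ClosedTwin G s t := fun t ht => (hone s hs).symm.trans (hone t ht)
    rcases hs' with hs' | hs'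
    · exact h.nonempty_iso_of_one_outside hX hs hs' hone'
    · exact h.symm.nonempty_iso_of_one_outside hX hs hs' hone'
  left
  push Not at hone
  obtain ⟨z, hz, hyz⟩ := hone
  by_cases htwo : ∀ t ∉ K, ClosedTwin G y t ∨ ClosedTwin G z t
  · obtain ⟨t, htK, ht⟩ : ∃ t ∈ Kᶜ, t ∉ ({y, z} : Finset V) :=
      Finset.exists_mem_notMem_of_card_lt_card (lt_of_le_of_lt Finset.card_le_two hXc)
    simp only [Finset.mem_insert, Finset.mem_singleton, not_or, Finset.mem_compl] at ht htK
    exact HasTwoOutsideClasses.exists_resolved_of_card hG ⟨h, hy, hz, hyz, htwo⟩ htK ht.1 ht.2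
      hlK hl.1 hl.2
  · push Not at htwo
    obtain ⟨t, ht, hyt, hzt⟩ := htwo
    rcases h.cover l hlK with h' | h'
    · exact h.exists_resolved_of_three_outside hG hlK hl.1 h' hy hz ht hyz hyt hzt
    · exact h.symm.exists_resolved_of_three_outside hG hlK hl.2 h' hy hz ht hyz hyt hzt

end IsTwoClassClique

end TwoOutsideClasses

/-! ### Assembly by the number of twin classes -/

section Main

theorem exists_resolved_or_extremal {V : Type*} [Fintype V] {G : SimpleGraph V} (hG : G.Connected)
    (hn : 5 ≤ Fintype.card V) (hω : G.cliqueNum ≤ Fintype.card V - 3) :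
    (∃ S : Finset V, S.card = 4 ∧ ResolvedFromOutside G S) ∨ Nonempty (G ≃g cycleGraph 5) ∨
      ∃ a b : ℕ, 2 ≤ b ∧ b ≤ a ∧ a + b < Fintype.card V ∧
        Nonempty (G ≃g completeMinusBipartite (Fintype.card V) a b) := by
  classical
  by_cases ht : ∀ a b c, G.Adj a b → G.Adj b c → ¬G.Adj a c
  · exact (exists_resolved_or_cycle_of_triangleFree hG hn ht).imp_right Or.inl
  push Not at ht
  obtain ⟨a, b, c, hab, hbc, hac⟩ := ht
  obtain ⟨K, hK⟩ := G.maximumClique_exists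
  have hKω := G.maximumClique_card_eq_cliqueNum K hK
  have hX : K.card + 3 ≤ Fintype.card V := by omega
  have hK3 : 3 ≤ K.card := by
    have h3 := (is3Clique_triple_iff (G := G)).2 ⟨hab, hac, hbc⟩
    have := hK.maximum _ h3.isClique
    rwa [h3.card_eq] at this
  obtain ⟨k₁, h1⟩ := Finset.card_pos.1 (by omega : 0 < K.card)
  obtain ⟨x, -, hx⟩ : ∃ x ∈ (Finset.univ : Finset V), x ∉ K :=
    Finset.exists_mem_notMem_of_card_lt_card (by rw [Finset.card_univ]; omega)
  obtain ⟨k₂, h2, h12⟩ : ∃ k₂ ∈ K, ¬ClosedTwin G k₁ k₂ := by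
    by_contra! hc
    exact hx (not_closedTwin_all hG hK h1 hc x)
  by_cases hc2 : ∀ l ∈ K, ClosedTwin G k₁ l ∨ ClosedTwin G k₂ l
  · exact (IsTwoClassClique.exists_resolved_or_iso hG ⟨hK, h1, h2, h12, hc2⟩ hX hK3).imp_right
      Or.inr
  left
  push Not at hc2
  obtain ⟨k₃, h3, h13, h23⟩ := hc2
  by_cases hc3 : ∀ l ∈ K, ClosedTwin G k₁ l ∨ ClosedTwin G k₂ l ∨ ClosedTwin G k₃ l
  · exact exists_resolved_of_three_classes hK hX h1 h2 h3 h12 h13 h23 hc3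
  push Not at hc3
  obtain ⟨k₄, h4, h14, h24, h34⟩ := hc3
  exact exists_resolved_of_four_classes hK.isClique h1 h2 h3 h4 h12 h13 h14 h23 h24 h34

end Main

theorem theorem2p2 {V : Type*} [Fintype V] (G : SimpleGraph V) (hconn : G.Connected)
    (hn : 5 ≤ Fintype.card V) (hω : G.cliqueNum ≤ Fintype.card V - 3) :
    localMetricDim G ≤ Fintype.card V - 3 ∧
      (localMetricDim G = Fintype.card V - 3 ↔
        Nonempty (G ≃g SimpleGraph.cycleGraph 5) ∨
          ∃ a b : ℕ, 2 ≤ b ∧ b ≤ a ∧ a + b < Fintype.card V ∧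
            Nonempty (G ≃g completeMinusBipartite (Fintype.card V) a b)) := by
  have transport : ∀ {n k : ℕ} {H : SimpleGraph (Fin n)}, (G ≃g H) →
      (∃ S : Finset (Fin n), S.card = k ∧ ResolvedFromOutside H S) →
      ∃ S : Finset V, S.card = k ∧ ResolvedFromOutside G S := by
    rintro n k H e ⟨S, hS, hS'⟩
    exact ⟨_, (Finset.card_map _).trans hS, hS'.map e.symm (e.connected_iff.1 hconn)⟩
  have hle : localMetricDim G ≤ Fintype.card V - 3 := by
    rw [localMetricDim_le_iff (by omega)]
    rcases exists_resolved_or_extremal hconn hn hω with ⟨S, hS, hS'⟩ | ⟨⟨e⟩⟩ |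
      ⟨a, b, hb, hba, hab, ⟨e⟩⟩
    · obtain ⟨T, hT, hTc⟩ := Finset.exists_subset_card_eq (s := S) (n := 3) (by omega)
      exact ⟨T, hTc, hS'.mono hT⟩
    · exact transport e exists_resolved_cycleGraph_five
    · exact transport e (exists_resolved_completeMinusBipartite hb hba hab)
  refine ⟨hle, ?_⟩
  -- Since `n ≥ 5`, the truncated differences `n - 3` and `n - 4` are consecutive.
  have heq : localMetricDim G = Fintype.card V - 3 ↔ ¬localMetricDim G ≤ Fintype.card V - 4 := by
    omega
  rw [heq, localMetricDim_le_iff (by omega)]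
  constructor
  · exact (exists_resolved_or_extremal hconn hn hω).resolve_left
  · rintro (⟨⟨e⟩⟩ | ⟨a, b, -, -, -, ⟨e⟩⟩) ⟨S, hS, hS'⟩
    · exact not_resolved_cycleGraph_five ((Finset.card_map _).trans hS) (hS'.map e hconn)
    · exact not_resolved_completeMinusBipartite (e.connected_iff.1 hconn)
        ((Finset.card_map _).trans hS) (hS'.map e hconn)
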